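/- Let $F$ be a non-discrete locally compact non-Archimedean field of characteristic different from $2$ (in particular, any non-dyadic such field), with absolute value $|\cdot|$, ring of integers $\mathcal{O}_F=\{x\in F:|x|\le 1\}$ and uniformizer $\varpi$. Fix a continuous unitary character $\chi$ of the additive group $F$ with $\chi|_{\mathcal{O}_F}\equiv 1$ and $\chi$ not constant on $\varpi^{-1}\mathcal{O}_F$. Let $\mathrm{GL}(\infty,\mathcal{O}_F)=\varinjlim \mathrm{GL}(n,\mathcal{O}_F)$, the limit being taken along the embeddings $a\mapsto \mathrm{diag}(a,1)$; let $\mathrm{Sym}(\mathbb{N},F)$ be the space of infinite symmetric matrices over $F$ with the topology of entrywise convergence, and $\mathrm{Sym}(\infty,F)$ the additive group of infinite symmetric matrices with finitely many nonzero entries. The group $\mathrm{GL}(\infty,\mathcal{O}_F)$ acts on both by $g\cdot S=gSg^t$. An invariant Borel probability measure $\nu$ on $\mathrm{Sym}(\mathbb{N},F)$ is ergodic if every invariant Borel set $\mathcal{A}$ satisfies $\nu(\mathcal{A})=0$ or $\nu(\mathrm{Sym}(\mathbb{N},F)\setminus\mathcal{A})=0$. Let $G=\mathrm{Sym}(\infty,F)\rtimes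 \mathrm{GL}(\infty,\mathcal{O}_F)$, with multiplication $(A,g)(B,h)=(A+gBg^t,gh)$ and the inductive limit topology of the groups $\mathrm{Sym}(n,F)\rtimes\mathrm{GL}(n,\mathcal{O}_F)$. A (strongly continuous) unitary representation of $G$ in a Hilbert space is called spherical if it is irreducible and has a nonzero $\mathrm{GL}(\infty,\mathcal{O}_F)$-invariant vector. For a $\mathrm{GL}(\infty,\mathcal{O}_F)$-invariant probability measure $\nu$ on $\mathrm{Sym}(\mathbb{N},F)$, let $\rho_\nu$ be the homomorphism from $G$ to the unitary group of $L^2(\mathrm{Sym}(\mathbb{N},F),\nu)$ with $\rho_\nu(A,g)=\rho_\nu(A)\rho_\nu(g)$, where $$(\rho_\nu(g)\xi)(S)=\xi(g^tSg),\qquad (\rho_\nu(A)\xi)(S)=\chi(\mathrm{tr}(AS))\,\xi(S),\qquad g\in\mathrm{GL}(\infty,\mathcal{O}_F),\ A\in\mathrm{Sym}(\infty,F).$$ Proposition. The map $\nu\mapsto\rho_\nu$ is a bijection from the set of ergodic $\mathrm{GL}(\infty,\mathcal{O}_F)$-invariant probability measures on $\mathrm{Sym}(\mathbb{N},F)$ onto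 the set of unitary equivalence classes of spherical representations of $G$. That is: for every such ergodic $\nu$ the representation $\rho_\nu$ is spherical; if $\rho_\nu$ and $\rho_{\nu'}$ are unitarily equivalent, then $\nu=\nu'$; and every spherical representation of $G$ is unitarily equivalent to $\rho_\nu$ for some ergodic $\nu$. -/

import Mathlib

open MeasureTheory

noncomputable section

namespace CartanMotion

/-! ### Infinite matrices -/

section InfiniteMatrices

variable {R : Type*} [CommRing R]

/-- The product of two infinite matrices. It is only used when all the sums are finite. -/
def infMul (A B : Matrix ℕ ℕ R) : Matrix ℕ ℕ R :=
  fun i j => ∑ᶠ k, A i k * B k j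

/-- The trace of an infinite matrix (used for matrices with finitely many nonzero rows). -/
def infTrace (A : Matrix ℕ ℕ R) : R := ∑ᶠ i, A i i

theorem infMul_apply_of_row {A : Matrix ℕ ℕ R} (B : Matrix ℕ ℕ R) {i : ℕ} (j : ℕ)
    {s : Finset ℕ} (hs : ∀ k, k ∉ s → A i k = 0) :
    infMul A B i j = ∑ k ∈ s, A i k * B k j := by
  refine finsum_eq_sum_of_support_subset _ fun k hk => ?_
  by_contra h
  exact hk (by simp [hs k h])

theorem infMul_transpose (A B : Matrix ℕ ℕ R) :
    (infMul A B).transpose = infMul B.transpose A.transpose := by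
  ext i j
  simp [infMul, Matrix.transpose_apply, mul_comm]

theorem infMul_assoc_apply {A B C : Matrix ℕ ℕ R} {i j : ℕ} {s t : Finset ℕ}
    (hs : ∀ k, k ∉ s → A i k = 0) (ht : ∀ k ∈ s, ∀ l, l ∉ t → B k l * C l j = 0) :
    infMul (infMul A B) C i j = infMul A (infMul B C) i j := by
  rw [infMul_apply_of_row (infMul B C) j hs]
  have h1 : infMul (infMul A B) C i j = ∑ l ∈ t, (∑ k ∈ s, A i k * B k l) * C l j := by
    have h2 : ∀ l, infMul A B i l = ∑ k ∈ s, A i k * B k l :=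
      fun l => infMul_apply_of_row B l hs
    change ∑ᶠ l, infMul A B i l * C l j = _
    simp only [h2]
    refine finsum_eq_sum_of_support_subset _ fun l hl => ?_
    by_contra h
    refine hl ?_
    simp only [Finset.sum_mul, mul_assoc]
    exact Finset.sum_eq_zero fun k hk => by rw [ht k hk l h, mul_zero]
  rw [h1]
  simp only [Finset.sum_mul]
  rw [Finset.sum_comm]
  refine Finset.sum_congr rfl fun k hk => ?_
  have h3 : infMul B C k j = ∑ l ∈ t, B k l * C l j := by
    refine finsum_eq_sum_of_support_subset _ fun l hl => ?_
    by_contra h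
    exact hl (ht k hk l h)
  rw [h3, Finset.mul_sum]
  exact Finset.sum_congr rfl fun l _ => by ring

/-- `A` coincides with the identity matrix outside the upper left `n × n` corner. -/
def IsOneOutside (n : ℕ) (A : Matrix ℕ ℕ R) : Prop :=
  ∀ i j, n ≤ i ∨ n ≤ j → A i j = (1 : Matrix ℕ ℕ R) i j

/-- `A` vanishes outside the upper left `n × n` corner. -/
def IsZeroOutside (n : ℕ) (A : Matrix ℕ ℕ R) : Prop :=
  ∀ i j, n ≤ i ∨ n ≤ j → A i j = 0

/-- Every row of `A` has finitely many nonzero entries. -/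
def RowFinite (A : Matrix ℕ ℕ R) : Prop :=
  ∀ i, ∃ s : Finset ℕ, ∀ k, k ∉ s → A i k = 0

theorem IsOneOutside.rowFinite {n : ℕ} {A : Matrix ℕ ℕ R} (h : IsOneOutside n A) :
    RowFinite A := fun i => by
  refine ⟨Finset.range (max n (i + 1)), fun k hk => ?_⟩
  simp only [Finset.mem_range, not_lt] at hk
  rw [h i k (Or.inr (le_trans (le_max_left _ _) hk)), Matrix.one_apply_ne]
  have := le_trans (le_max_right n (i + 1)) hk
  omega

theorem IsZeroOutside.rowFinite {n : ℕ} {A : Matrix ℕ ℕ R} (h : IsZeroOutside n A) :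
    RowFinite A := fun i =>
  ⟨Finset.range n, fun k hk => h i k (Or.inr (by simpa using hk))⟩

theorem IsOneOutside.transpose {n : ℕ} {A : Matrix ℕ ℕ R} (h : IsOneOutside n A) :
    IsOneOutside n A.transpose := fun i j hij => by
  rw [Matrix.transpose_apply, h j i hij.symm]
  by_cases hij' : i = j
  · rw [hij']
  · rw [Matrix.one_apply_ne hij', Matrix.one_apply_ne (Ne.symm hij')]

theorem IsZeroOutside.transpose {n : ℕ} {A : Matrix ℕ ℕ R} (h : IsZeroOutside n A) :
    IsZeroOutside n A.transpose := fun i j hij => h j i hij.symm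

/-- `(A B) C = A (B C)` if `A` and `B` have finite rows. -/
theorem infMul_assoc_left {A B : Matrix ℕ ℕ R} (C : Matrix ℕ ℕ R) (hA : RowFinite A)
    (hB : RowFinite B) : infMul (infMul A B) C = infMul A (infMul B C) := by
  classical
  ext i j
  obtain ⟨s, hs⟩ := hA i
  choose t ht using hB
  refine infMul_assoc_apply (t := s.biUnion t) hs fun k hk l hl => ?_
  rw [ht k l fun h => hl (Finset.mem_biUnion.2 ⟨k, hk, h⟩), zero_mul]

/-- `(A B) C = A (B C)` if `A` has finite rows and `C` has finite columns. -/
theorem infMul_assoc_mid {A C : Matrix ℕ ℕ R} (B : Matrix ℕ ℕ R) (hA : RowFinite A)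
    (hC : RowFinite C.transpose) : infMul (infMul A B) C = infMul A (infMul B C) := by
  ext i j
  obtain ⟨s, hs⟩ := hA i
  obtain ⟨t, ht⟩ := hC j
  exact infMul_assoc_apply hs fun k _ l hl => by
    rw [show C l j = 0 from ht l hl, mul_zero]

/-- `(A B) C = A (B C)` if `B` and `C` have finite columns. -/
theorem infMul_assoc_right {B C : Matrix ℕ ℕ R} (A : Matrix ℕ ℕ R)
    (hB : RowFinite B.transpose) (hC : RowFinite C.transpose) :
    infMul (infMul A B) C = infMul A (infMul B C) := by
  apply Matrix.transpose_injective
  simp only [infMul_transpose]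
  exact (infMul_assoc_left _ hC hB).symm

theorem one_infMul (A : Matrix ℕ ℕ R) : infMul 1 A = A := by
  ext i j
  rw [infMul_apply_of_row (s := {i}) A j fun k hk => by
    rw [Matrix.one_apply_ne]; exact fun h => hk (by simp [h])]
  simp

theorem infMul_one (A : Matrix ℕ ℕ R) : infMul A 1 = A := by
  apply Matrix.transpose_injective
  rw [infMul_transpose, Matrix.transpose_one, one_infMul]

theorem isOneOutside_one (n : ℕ) : IsOneOutside n (1 : Matrix ℕ ℕ R) := fun _ _ _ => rfl

/-- A row of a matrix in the upper part of the identity acts trivially. -/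
theorem IsOneOutside.infMul_apply {n : ℕ} {A : Matrix ℕ ℕ R} (h : IsOneOutside n A)
    (B : Matrix ℕ ℕ R) {i : ℕ} (j : ℕ) (hi : n ≤ i) : infMul A B i j = B i j := by
  rw [infMul_apply_of_row (s := {i}) B j fun k hk => by
    rw [h i k (Or.inl hi), Matrix.one_apply_ne]; exact fun h => hk (by simp [h])]
  simp [h i i (Or.inl hi)]

theorem IsOneOutside.mono {n m : ℕ} {A : Matrix ℕ ℕ R} (h : IsOneOutside n A) (hnm : n ≤ m) :
    IsOneOutside m A := fun i j hij => h i j (hij.imp hnm.trans hnm.trans)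

theorem IsZeroOutside.mono {n m : ℕ} {A : Matrix ℕ ℕ R} (h : IsZeroOutside n A) (hnm : n ≤ m) :
    IsZeroOutside m A := fun i j hij => h i j (hij.imp hnm.trans hnm.trans)

theorem IsOneOutside.infMul {n : ℕ} {A B : Matrix ℕ ℕ R} (hA : IsOneOutside n A)
    (hB : IsOneOutside n B) : IsOneOutside n (infMul A B) := by
  intro i j hij
  rcases hij with hi | hj
  · rw [hA.infMul_apply B j hi, hB i j (Or.inl hi)]
  · rw [← Matrix.transpose_apply (CartanMotion.infMul A B) j i, infMul_transpose,
      hB.transpose.infMul_apply _ i hj, Matrix.transpose_apply, hA i j (Or.inr hj)]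

theorem IsOneOutside.infMul_isZeroOutside {n : ℕ} {A B : Matrix ℕ ℕ R} (hA : IsOneOutside n A)
    (hB : IsZeroOutside n B) : IsZeroOutside n (CartanMotion.infMul A B) := by
  intro i j hij
  rcases hij with hi | hj
  · rw [hA.infMul_apply B j hi, hB i j (Or.inl hi)]
  · exact finsum_eq_zero_of_forall_eq_zero fun k => by rw [hB k j (Or.inr hj), mul_zero]

theorem infMul_add_of_row {A : Matrix ℕ ℕ R} (hA : RowFinite A) (B C : Matrix ℕ ℕ R) :
    infMul A (B + C) = infMul A B + infMul A C := by
  ext i j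
  obtain ⟨s, hs⟩ := hA i
  simp only [Matrix.add_apply, infMul_apply_of_row _ j hs, mul_add, Finset.sum_add_distrib]

theorem add_infMul_of_col {C : Matrix ℕ ℕ R} (hC : RowFinite C.transpose) (A B : Matrix ℕ ℕ R) :
    infMul (A + B) C = infMul A C + infMul B C := by
  apply Matrix.transpose_injective
  simp only [infMul_transpose, Matrix.transpose_add, infMul_add_of_row hC]

theorem IsZeroOutside.infTrace_infMul {n : ℕ} {A : Matrix ℕ ℕ R} (hA : IsZeroOutside n A)
    (B : Matrix ℕ ℕ R) :
    infTrace (CartanMotion.infMul A B) =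
      ∑ i ∈ Finset.range n, ∑ k ∈ Finset.range n, A i k * B k i := by
  have h : ∀ i j, CartanMotion.infMul A B i j = ∑ k ∈ Finset.range n, A i k * B k j :=
    fun i j => infMul_apply_of_row B j fun k hk => hA i k (Or.inr (by simpa using hk))
  unfold infTrace
  simp only [h]
  refine finsum_eq_sum_of_support_subset _ fun i hi => ?_
  by_contra hn
  refine hi (Finset.sum_eq_zero fun k _ => ?_)
  rw [hA i k (Or.inl (by simpa using hn)), zero_mul]

theorem IsZeroOutside.infTrace_comm {n : ℕ} {A : Matrix ℕ ℕ R} (hA : IsZeroOutside n A)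
    (B : Matrix ℕ ℕ R) :
    infTrace (CartanMotion.infMul A B) = infTrace (CartanMotion.infMul B A) := by
  have h : infTrace (CartanMotion.infMul B A) =
      infTrace (CartanMotion.infMul A.transpose B.transpose) := by
    rw [← infMul_transpose]; rfl
  rw [h, hA.infTrace_infMul, hA.transpose.infTrace_infMul, Finset.sum_comm]
  simp only [Matrix.transpose_apply]

variable (R) in
/-- The monoid of infinite matrices over `R` which coincide with the identity matrix outside some
finite upper left corner. -/
def FinMat : Type _ := {A : Matrix ℕ ℕ R // ∃ n, IsOneOutside n A}

instance : Monoid (FinMat R) where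
  mul A B := ⟨infMul A.1 B.1, by
    obtain ⟨n, hn⟩ := A.2
    obtain ⟨m, hm⟩ := B.2
    exact ⟨max n m, (hn.mono (le_max_left _ _)).infMul (hm.mono (le_max_right _ _))⟩⟩
  one := ⟨1, 0, isOneOutside_one 0⟩
  mul_assoc A B C := Subtype.ext <| by
    obtain ⟨n, hn⟩ := A.2
    obtain ⟨m, hm⟩ := B.2
    exact infMul_assoc_left C.1 hn.rowFinite hm.rowFinite
  one_mul A := Subtype.ext (one_infMul A.1)
  mul_one A := Subtype.ext (infMul_one A.1)

/-- The infinite matrix with upper left corner `a` and zeros elsewhere. -/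
def extendZero (n : ℕ) (a : Matrix (Fin n) (Fin n) R) : Matrix ℕ ℕ R :=
  fun i j => if h : i < n ∧ j < n then a ⟨i, h.1⟩ ⟨j, h.2⟩ else 0

/-- The infinite block diagonal matrix `diag(a, 1, 1, …)`. -/
def extendOne (n : ℕ) (a : Matrix (Fin n) (Fin n) R) : Matrix ℕ ℕ R :=
  fun i j => if h : i < n ∧ j < n then a ⟨i, h.1⟩ ⟨j, h.2⟩ else (1 : Matrix ℕ ℕ R) i j

theorem isZeroOutside_extendZero (n : ℕ) (a : Matrix (Fin n) (Fin n) R) :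
    IsZeroOutside n (extendZero n a) := fun i j hij => by
  unfold extendZero
  rw [dif_neg (by omega)]

theorem isOneOutside_extendOne (n : ℕ) (a : Matrix (Fin n) (Fin n) R) :
    IsOneOutside n (extendOne n a) := fun i j hij => by
  unfold extendOne
  rw [dif_neg (by omega)]

/-- The embedding `a ↦ diag(a, 1, 1, …)` is multiplicative. -/
def extendHom (n : ℕ) : Matrix (Fin n) (Fin n) R →* FinMat R where
  toFun a := ⟨extendOne n a, n, isOneOutside_extendOne n a⟩
  map_one' := Subtype.ext <| by
    change extendOne n 1 = 1
    ext i j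
    unfold extendOne
    split_ifs with h
    · simp [Matrix.one_apply]
    · rfl
  map_mul' a b := Subtype.ext <| by
    change extendOne n (a * b) = infMul (extendOne n a) (extendOne n b)
    have hmul := (isOneOutside_extendOne n a).infMul (isOneOutside_extendOne n b)
    ext i j
    by_cases h : i < n ∧ j < n
    · rw [infMul_apply_of_row (s := Finset.range n) _ j fun k hk => by
        have hk' : n ≤ k := by simpa using hk
        rw [isOneOutside_extendOne n a i k (Or.inr hk'), Matrix.one_apply_ne (by omega)]]
      rw [Finset.sum_range]
      simp only [extendOne, h.1, h.2, Fin.is_lt, and_self, dite_true]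
      rfl
    · rw [hmul i j (by omega), isOneOutside_extendOne n _ i j (by omega)]

end InfiniteMatrices

/-! ### The groups and spaces attached to the field -/

section Groups

variable (F : Type*) [NontriviallyNormedField F] [IsUltrametricDist F]

/-- The ring of integers `{x | ‖x‖ ≤ 1}` of `F`. -/
abbrev IntRing : Subring F := (NormedField.valuation (K := F)).integer

/-- `GL(∞, 𝒪)`: the invertible infinite matrices over the ring of integers which coincide with
the identity matrix outside some finite corner (the increasing union of the `GL(n, 𝒪)`). -/
def GLInf : Type _ := (FinMat (IntRing F))ˣ

instance : Group (GLInf F) := inferInstanceAs (Group (FinMat (IntRing F))ˣ)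

variable {F} in
/-- The infinite matrix over `F` underlying an element of `GL(∞, 𝒪)`. -/
def GLInf.mat (g : GLInf F) : Matrix ℕ ℕ F := fun i j => (g.val.1 i j : F)

/-- `Sym(ℕ, F)`: infinite symmetric matrices. -/
def symSubgroup : AddSubgroup (Matrix ℕ ℕ F) where
  carrier := {S | S.IsSymm}
  add_mem' := fun ha hb => Matrix.IsSymm.add ha hb
  zero_mem' := Matrix.isSymm_zero
  neg_mem' := fun ha => Matrix.IsSymm.neg ha

/-- `Sym(∞, F)`: infinite symmetric matrices with finitely many nonzero entries. -/
def symFinSubgroup : AddSubgroup (Matrix ℕ ℕ F) where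
  carrier := {S | S.IsSymm ∧ ∃ n, IsZeroOutside n S}
  add_mem' := by
    rintro A B ⟨hA, n, hn⟩ ⟨hB, m, hm⟩
    refine ⟨hA.add hB, max n m, fun i j hij => ?_⟩
    rw [Matrix.add_apply, hn.mono (le_max_left n m) i j hij, hm.mono (le_max_right n m) i j hij,
      add_zero]
  zero_mem' := ⟨Matrix.isSymm_zero, 0, fun _ _ _ => rfl⟩
  neg_mem' := by
    rintro A ⟨hA, n, hn⟩
    exact ⟨hA.neg, n, fun i j hij => by rw [Matrix.neg_apply, hn i j hij, neg_zero]⟩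

/-- The space `Sym(ℕ, F)`, with the topology of entrywise convergence. -/
abbrev SymN : Type _ := ↥(symSubgroup F)

/-- The additive group `Sym(∞, F)`. -/
abbrev SymInf : Type _ := ↥(symFinSubgroup F)

/-- `Sym(ℕ, F)` carries its Borel σ-algebra. -/
instance : MeasurableSpace (SymN F) := borel _

instance : BorelSpace (SymN F) := ⟨rfl⟩

variable {F}

theorem GLInf.exists_isOneOutside (g : GLInf F) : ∃ n, IsOneOutside n g.mat := by
  obtain ⟨n, hn⟩ := g.val.2
  refine ⟨n, fun i j hij => ?_⟩
  unfold GLInf.mat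
  rw [hn i j hij]
  by_cases h : i = j <;> simp [Matrix.one_apply, h]

theorem GLInf.rowFinite (g : GLInf F) : RowFinite g.mat :=
  let ⟨_, hn⟩ := g.exists_isOneOutside
  hn.rowFinite

theorem GLInf.rowFinite_transpose (g : GLInf F) : RowFinite g.mat.transpose :=
  let ⟨_, hn⟩ := g.exists_isOneOutside
  hn.transpose.rowFinite

theorem GLInf.mat_one : (1 : GLInf F).mat = 1 := by
  ext i j
  change (((1 : Matrix ℕ ℕ (IntRing F)) i j : IntRing F) : F) = _
  by_cases h : i = j <;> simp [Matrix.one_apply, h]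

theorem GLInf.mat_mul (g h : GLInf F) : (g * h).mat = infMul g.mat h.mat := by
  ext i j
  obtain ⟨n, hn⟩ := g.val.2
  obtain ⟨s, hs⟩ := hn.rowFinite i
  change ((infMul g.val.1 h.val.1 i j : IntRing F) : F) = _
  rw [infMul_apply_of_row _ j hs, infMul_apply_of_row (s := s) _ j fun k hk => by
    change ((g.val.1 i k : IntRing F) : F) = 0
    rw [hs k hk]; rfl]
  simp [GLInf.mat]

/-- The transpose `gᵗ` of an element of `GL(∞, 𝒪)`. -/
def GLInf.transpose (g : GLInf F) : GLInf F :=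
  let t : FinMat (IntRing F) → FinMat (IntRing F) :=
    fun a => ⟨a.1.transpose, let ⟨n, hn⟩ := a.2; ⟨n, hn.transpose⟩⟩
  have ht : ∀ a b, t a * t b = t (b * a) := fun a b =>
    Subtype.ext (infMul_transpose b.1 a.1).symm
  have h1 : t 1 = 1 := Subtype.ext Matrix.transpose_one
  { val := t g.val
    inv := t g.inv
    val_inv := by rw [ht, g.inv_val, h1]
    inv_val := by rw [ht, g.val_inv, h1] }

theorem GLInf.mat_transpose (g : GLInf F) : g.transpose.mat = g.mat.transpose := rfl

theorem GLInf.mat_injective : Function.Injective (GLInf.mat (F := F)) := fun g h hgh => by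
  refine Units.ext (Subtype.ext ?_)
  ext i j
  exact congrFun (congrFun hgh i) j

theorem GLInf.transpose_one : (1 : GLInf F).transpose = 1 :=
  GLInf.mat_injective (by rw [mat_transpose, mat_one, Matrix.transpose_one])

theorem GLInf.transpose_mul (g h : GLInf F) :
    (g * h).transpose = h.transpose * g.transpose :=
  GLInf.mat_injective (by simp only [mat_transpose, mat_mul, infMul_transpose])

/-- The matrix `g S gᵗ`. -/
def conjMat (g : GLInf F) (S : Matrix ℕ ℕ F) : Matrix ℕ ℕ F :=
  infMul (infMul g.mat S) g.mat.transpose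

theorem conjMat_one (S : Matrix ℕ ℕ F) : conjMat 1 S = S := by
  rw [conjMat, GLInf.mat_one, one_infMul, Matrix.transpose_one, infMul_one]

theorem conjMat_mul (g h : GLInf F) (S : Matrix ℕ ℕ F) :
    conjMat (g * h) S = conjMat g (conjMat h S) := by
  simp only [conjMat, GLInf.mat_mul, infMul_transpose]
  rw [infMul_assoc_left S g.rowFinite h.rowFinite,
    ← infMul_assoc_right (B := h.mat.transpose) (C := g.mat.transpose) _ h.rowFinite g.rowFinite,
    infMul_assoc_mid (C := h.mat.transpose) _ g.rowFinite h.rowFinite]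

theorem conjMat_isSymm (g : GLInf F) {S : Matrix ℕ ℕ F} (hS : S.IsSymm) :
    (conjMat g S).IsSymm := by
  unfold Matrix.IsSymm conjMat
  rw [infMul_transpose, infMul_transpose, Matrix.transpose_transpose, hS.eq,
    infMul_assoc_mid (C := g.mat.transpose) _ g.rowFinite g.rowFinite]

theorem conjMat_add (g : GLInf F) (S T : Matrix ℕ ℕ F) :
    conjMat g (S + T) = conjMat g S + conjMat g T := by
  unfold conjMat
  rw [infMul_add_of_row g.rowFinite, add_infMul_of_col (C := g.mat.transpose) g.rowFinite]

theorem conjMat_isZeroOutside (g : GLInf F) {A : Matrix ℕ ℕ F} (hA : ∃ n, IsZeroOutside n A) :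
    ∃ n, IsZeroOutside n (conjMat g A) := by
  obtain ⟨n, hn⟩ := hA
  obtain ⟨m, hm⟩ := g.exists_isOneOutside
  refine ⟨max n m, ?_⟩
  have hn' := hn.mono (le_max_left n m)
  have hm' := hm.mono (le_max_right n m)
  have h := (hm'.infMul_isZeroOutside (hm'.infMul_isZeroOutside hn').transpose).transpose
  rwa [infMul_transpose, Matrix.transpose_transpose] at h

/-- The action of `GL(∞, 𝒪)` on `Sym(ℕ, F)`: `g • S = g S gᵗ`. -/
instance : MulAction (GLInf F) (SymN F) where
  smul g S := ⟨conjMat g S.1, conjMat_isSymm g S.2⟩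
  one_smul S := Subtype.ext (conjMat_one S.1)
  mul_smul g h S := Subtype.ext (conjMat_mul g h S.1)

theorem smul_symN_coe (g : GLInf F) (S : SymN F) :
    ((g • S : SymN F) : Matrix ℕ ℕ F) = conjMat g S.1 := rfl

/-- The action of `GL(∞, 𝒪)` on `Sym(∞, F)`, written multiplicatively: `g • A = g A gᵗ`. -/
instance : MulDistribMulAction (GLInf F) (Multiplicative (SymInf F)) where
  smul g A := Multiplicative.ofAdd
    ⟨conjMat g A.toAdd.1, conjMat_isSymm g A.toAdd.2.1, conjMat_isZeroOutside g A.toAdd.2.2⟩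
  one_smul A := Subtype.ext (conjMat_one A.toAdd.1)
  mul_smul g h A := Subtype.ext (conjMat_mul g h A.toAdd.1)
  smul_mul g A B := Subtype.ext (conjMat_add g A.toAdd.1 B.toAdd.1)
  smul_one g := Subtype.ext <| by
    have h := conjMat_add g (0 : Matrix ℕ ℕ F) 0
    rw [add_zero] at h
    exact left_eq_add.1 h

variable (F) in
/-- The semidirect product `Sym(∞, F) ⋊ GL(∞, 𝒪)`, with the multiplication
`(A, g) (B, h) = (A + g B gᵗ, g h)`. -/
def MotionGroup : Type _ :=
  Multiplicative (SymInf F) ⋊[MulDistribMulAction.toMulAut (GLInf F) (Multiplicative (SymInf F))]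
    GLInf F

instance : Group (MotionGroup F) := inferInstanceAs (Group (Multiplicative (SymInf F)
  ⋊[MulDistribMulAction.toMulAut (GLInf F) (Multiplicative (SymInf F))] GLInf F))

/-- The element `(A, g)` of the semidirect product. -/
def MotionGroup.mk (A : SymInf F) (g : GLInf F) : MotionGroup F :=
  (⟨Multiplicative.ofAdd A, g⟩ : Multiplicative (SymInf F)
    ⋊[MulDistribMulAction.toMulAut (GLInf F) (Multiplicative (SymInf F))] GLInf F)

theorem MotionGroup.mk_mul_mk (A B : SymInf F) (g h : GLInf F) :
    MotionGroup.mk A g * MotionGroup.mk B h =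
      MotionGroup.mk (A + (g • Multiplicative.ofAdd B).toAdd) (g * h) := rfl

/-- The embedding of `Sym(n, F) × GL(n, 𝒪)` (the underlying space of the `n`-th motion group)
into `Sym(∞, F) ⋊ GL(∞, 𝒪)`. -/
def MotionGroup.stage (n : ℕ)
    (x : {a : Matrix (Fin n) (Fin n) F // a.IsSymm} × GL (Fin n) (IntRing F)) : MotionGroup F :=
  MotionGroup.mk
    ⟨extendZero n x.1.1, by
      refine ⟨Matrix.IsSymm.ext fun i j => ?_, n, isZeroOutside_extendZero n x.1.1⟩
      unfold extendZero
      by_cases h : i < n ∧ j < n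
      · rw [dif_pos h, dif_pos h.symm, x.1.2.apply]
      · rw [dif_neg h, dif_neg fun h' => h h'.symm]⟩
    (Units.map (extendHom n) x.2)

/-- The inductive limit topology: the finest topology for which all the maps
`Sym(n, F) × GL(n, 𝒪) → Sym(∞, F) ⋊ GL(∞, 𝒪)` are continuous. -/
instance : TopologicalSpace (MotionGroup F) :=
  ⨆ n : ℕ, TopologicalSpace.coinduced (MotionGroup.stage n) inferInstance

/-- `ϖ` is a uniformizer: it generates the maximal ideal `{x | ‖x‖ < 1}` of the ring of
integers. -/
def IsUniformizer (ϖ : F) : Prop :=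
  ∀ x : F, ‖x‖ < 1 ↔ ∃ y : F, ‖y‖ ≤ 1 ∧ x = ϖ * y

/-- A Borel probability measure on `Sym(ℕ, F)` which is invariant and ergodic for the action
`g • S = g S gᵗ` of `GL(∞, 𝒪)`. -/
structure IsErgodicProb (ν : Measure (SymN F)) : Prop where
  isProb : IsProbabilityMeasure ν
  invariant : SMulInvariantMeasure (GLInf F) (SymN F) ν
  ergodic : ∀ s : Set (SymN F), MeasurableSet s → (∀ g : GLInf F, (fun S => g • S) ⁻¹' s = s) →
    ν s = 0 ∨ ν sᶜ = 0

end Groups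

/-! ### Unitary representations -/

section Representations

variable {F : Type*} [NontriviallyNormedField F] [IsUltrametricDist F]

/-- A homomorphism from `Sym(∞, F) ⋊ GL(∞, 𝒪)` into the unitary group of `H` is a spherical
representation if it is strongly continuous, (topologically) irreducible, and has a nonzero
`GL(∞, 𝒪)`-invariant vector. -/
structure IsSpherical {H : Type*} [NormedAddCommGroup H] [InnerProductSpace ℂ H]
    (ρ : MotionGroup F →* (H ≃ₗᵢ[ℂ] H)) : Prop where
  continuous : ∀ v : H, Continuous fun x => ρ x v
  irreducible : ∀ W : Submodule ℂ H, IsClosed (W : Set H) →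
    (∀ x, ∀ v ∈ W, ρ x v ∈ W) → W = ⊥ ∨ W = ⊤
  exists_invariant : ∃ v : H, v ≠ 0 ∧ ∀ g : GLInf F, ρ (MotionGroup.mk 0 g) v = v

/-- Unitary equivalence of representations. -/
def UnitarilyEquivalent {G H H' : Type*} [Group G] [NormedAddCommGroup H] [InnerProductSpace ℂ H]
    [NormedAddCommGroup H'] [InnerProductSpace ℂ H']
    (ρ : G →* (H ≃ₗᵢ[ℂ] H)) (ρ' : G →* (H' ≃ₗᵢ[ℂ] H')) : Prop :=
  ∃ U : H ≃ₗᵢ[ℂ] H', ∀ x v, U (ρ x v) = ρ' x (U v)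

theorem continuous_smul_symN (g : GLInf F) : Continuous fun S : SymN F => g • S := by
  refine Continuous.subtype_mk (continuous_matrix fun i j => ?_) _
  choose s hs using g.rowFinite
  have h1 : ∀ (S : SymN F) (i l : ℕ),
      infMul g.mat S.1 i l = ∑ k ∈ s i, g.mat i k * S.1 k l :=
    fun S i l => infMul_apply_of_row _ l (hs i)
  have h2 : ∀ S : SymN F, conjMat g S.1 i j =
      ∑ l ∈ s j, g.mat j l * ∑ k ∈ s i, g.mat i k * S.1 k l := fun S => by
    rw [conjMat, ← Matrix.transpose_apply (infMul _ _) j i, infMul_transpose,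
      Matrix.transpose_transpose, infMul_apply_of_row _ i (hs j)]
    simp only [Matrix.transpose_apply, h1]
  simp only [h2]
  refine continuous_finsetSum _ fun l _ => continuous_const.mul
    (continuous_finsetSum _ fun k _ => continuous_const.mul ?_)
  exact continuous_subtype_val.matrix_elem k l

theorem measurePreserving_smul_symN (ν : Measure (SymN F))
    [SMulInvariantMeasure (GLInf F) (SymN F) ν] (g : GLInf F) :
    MeasurePreserving (fun S : SymN F => g • S) ν ν := by
  refine ⟨(continuous_smul_symN g).measurable, Measure.ext fun s hs => ?_⟩
  rw [Measure.map_apply (continuous_smul_symN g).measurable hs,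
    SMulInvariantMeasure.measure_preimage_smul g hs]

/-- The pairing `tr(A S)` between `Sym(∞, F)` and `Sym(ℕ, F)`. -/
def pairing (A : SymInf F) (S : SymN F) : F := infTrace (infMul A.1 S.1)

theorem continuous_pairing (A : SymInf F) : Continuous (pairing A) := by
  obtain ⟨n, hn⟩ := A.2.2
  have h : pairing A = fun S : SymN F =>
      ∑ i ∈ Finset.range n, ∑ k ∈ Finset.range n, A.1 i k * S.1 k i :=
    funext fun S => hn.infTrace_infMul S.1
  rw [h]
  exact continuous_finsetSum _ fun i _ => continuous_finsetSum _ fun k _ =>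
    continuous_const.mul (continuous_subtype_val.matrix_elem k i)

theorem pairing_add (A B : SymInf F) (S : SymN F) :
    pairing (A + B) S = pairing A S + pairing B S := by
  obtain ⟨n, hn⟩ := A.2.2
  obtain ⟨m, hm⟩ := B.2.2
  obtain ⟨l, hl⟩ := (A + B).2.2
  have h1 := (hn.mono ((le_max_left n m).trans (le_max_left _ l))).infTrace_infMul S.1
  have h2 := (hm.mono ((le_max_right n m).trans (le_max_left _ l))).infTrace_infMul S.1
  have h3 := (hl.mono (le_max_right (max n m) l)).infTrace_infMul S.1
  unfold pairing
  rw [h1, h2, h3, ← Finset.sum_add_distrib]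
  refine Finset.sum_congr rfl fun i _ => ?_
  rw [← Finset.sum_add_distrib]
  exact Finset.sum_congr rfl fun k _ => add_mul _ _ _

theorem pairing_smul (g : GLInf F) (A : SymInf F) (S : SymN F) :
    pairing (g • Multiplicative.ofAdd A).toAdd S = pairing A (g.transpose • S) := by
  obtain ⟨n, hn⟩ := A.2.2
  obtain ⟨m, hm⟩ := g.exists_isOneOutside
  have hgA : IsZeroOutside (max n m) (infMul g.mat A.1) :=
    (hm.mono (le_max_right n m)).infMul_isZeroOutside (hn.mono (le_max_left n m))
  change infTrace (infMul (infMul (infMul g.mat A.1) g.mat.transpose) S.1) =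
    infTrace (infMul A.1 (infMul (infMul g.mat.transpose S.1) g.mat.transpose.transpose))
  rw [Matrix.transpose_transpose, infMul_assoc_left _ hgA.rowFinite g.rowFinite_transpose,
    hgA.infTrace_comm, hn.infTrace_comm,
    infMul_assoc_right _ g.rowFinite_transpose hn.transpose.rowFinite]

/-- The function `S ↦ χ(tr(A S)) ξ(S)` is square integrable when `ξ` is. -/
theorem memLp_character_mul {χ : AddChar F Circle} (hχ : Continuous χ) {ν : Measure (SymN F)}
    (A : SymInf F) (ξ : Lp ℂ 2 ν) :
    MemLp (fun S => (χ (pairing A S) : ℂ) * ξ S) 2 ν := by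
  have hc : Continuous fun S : SymN F => (χ (pairing A S) : ℂ) :=
    (by fun_prop : Continuous fun z : Circle => (z : ℂ)).comp (hχ.comp (continuous_pairing A))
  refine (memLp_congr_norm (hc.aestronglyMeasurable.mul (Lp.aestronglyMeasurable ξ))
    (Lp.aestronglyMeasurable ξ) (Filter.Eventually.of_forall fun S => ?_)).2 (Lp.memLp ξ)
  change ‖(χ (pairing A S) : ℂ) * ξ S‖ = ‖ξ S‖
  rw [norm_mul, Circle.norm_coe, one_mul]

/-- The operator `(ρ(A) ξ)(S) = χ(tr(A S)) ξ(S)` on `L²(Sym(ℕ, F), ν)`. -/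
def mulOp {χ : AddChar F Circle} (hχ : Continuous χ) (ν : Measure (SymN F)) (A : SymInf F) :
    Lp ℂ 2 ν →ₗᵢ[ℂ] Lp ℂ 2 ν where
  toFun ξ := (memLp_character_mul hχ A ξ).toLp _
  map_add' ξ η := by
    ext1
    filter_upwards [(memLp_character_mul hχ A (ξ + η)).coeFn_toLp,
      (memLp_character_mul hχ A ξ).coeFn_toLp, (memLp_character_mul hχ A η).coeFn_toLp,
      Lp.coeFn_add ξ η, Lp.coeFn_add ((memLp_character_mul hχ A ξ).toLp _)
        ((memLp_character_mul hχ A η).toLp _)] with S h1 h2 h3 h4 h5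
    rw [h1, h5, Pi.add_apply, h2, h3, h4, Pi.add_apply, mul_add]
  map_smul' c ξ := by
    ext1
    filter_upwards [(memLp_character_mul hχ A (c • ξ)).coeFn_toLp,
      (memLp_character_mul hχ A ξ).coeFn_toLp, Lp.coeFn_smul c ξ,
      Lp.coeFn_smul c ((memLp_character_mul hχ A ξ).toLp _)] with S h1 h2 h3 h4
    simp only [RingHom.id_apply]
    rw [h1, h4, Pi.smul_apply, h2, h3, Pi.smul_apply, smul_eq_mul, smul_eq_mul, mul_left_comm]
  norm_map' ξ := by
    change ‖(memLp_character_mul hχ A ξ).toLp _‖ = ‖ξ‖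
    rw [Lp.norm_toLp, Lp.norm_def]
    congr 1
    exact eLpNorm_congr_norm_ae (Filter.Eventually.of_forall fun S => by
      rw [norm_mul, Circle.norm_coe, one_mul])

theorem coeFn_mulOp {χ : AddChar F Circle} (hχ : Continuous χ) (ν : Measure (SymN F))
    (A : SymInf F) (ξ : Lp ℂ 2 ν) :
    mulOp hχ ν A ξ =ᵐ[ν] fun S => (χ (pairing A S) : ℂ) * ξ S :=
  (memLp_character_mul hχ A ξ).coeFn_toLp

theorem mulOp_add {χ : AddChar F Circle} (hχ : Continuous χ) (ν : Measure (SymN F))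
    (A B : SymInf F) (ξ : Lp ℂ 2 ν) :
    mulOp hχ ν (A + B) ξ = mulOp hχ ν A (mulOp hχ ν B ξ) := by
  ext1
  filter_upwards [coeFn_mulOp hχ ν (A + B) ξ, coeFn_mulOp hχ ν A (mulOp hχ ν B ξ),
    coeFn_mulOp hχ ν B ξ] with S h1 h2 h3
  rw [h1, h2, h3, pairing_add, AddChar.map_add_eq_mul, Circle.coe_mul, mul_assoc]

theorem mulOp_zero {χ : AddChar F Circle} (hχ : Continuous χ) (ν : Measure (SymN F))
    (ξ : Lp ℂ 2 ν) : mulOp hχ ν 0 ξ = ξ := by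
  refine (mulOp hχ ν 0).injective ?_
  rw [← mulOp_add, add_zero]

/-- The operator `(ρ(g) ξ)(S) = ξ(gᵗ S g)` on `L²(Sym(ℕ, F), ν)`. -/
def transOp (ν : Measure (SymN F)) [SMulInvariantMeasure (GLInf F) (SymN F) ν] (g : GLInf F) :
    Lp ℂ 2 ν →ₗᵢ[ℂ] Lp ℂ 2 ν :=
  Lp.compMeasurePreservingₗᵢ ℂ (fun S : SymN F => g.transpose • S)
    (measurePreserving_smul_symN ν g.transpose)

theorem coeFn_transOp (ν : Measure (SymN F)) [SMulInvariantMeasure (GLInf F) (SymN F) ν]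
    (g : GLInf F) (ξ : Lp ℂ 2 ν) :
    transOp ν g ξ =ᵐ[ν] fun S => ξ (g.transpose • S) :=
  Lp.coeFn_compMeasurePreserving ξ (measurePreserving_smul_symN ν g.transpose)

theorem transOp_mul (ν : Measure (SymN F)) [SMulInvariantMeasure (GLInf F) (SymN F) ν]
    (g h : GLInf F) (ξ : Lp ℂ 2 ν) : transOp ν (g * h) ξ = transOp ν g (transOp ν h ξ) := by
  ext1
  filter_upwards [coeFn_transOp ν (g * h) ξ, coeFn_transOp ν g (transOp ν h ξ),
    (measurePreserving_smul_symN ν g.transpose).quasiMeasurePreserving.ae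
      (coeFn_transOp ν h ξ)] with S h1 h2 h3
  rw [h1, h2, h3, GLInf.transpose_mul, mul_smul]

theorem transOp_one (ν : Measure (SymN F)) [SMulInvariantMeasure (GLInf F) (SymN F) ν]
    (ξ : Lp ℂ 2 ν) : transOp ν 1 ξ = ξ := by
  refine (transOp ν 1).injective ?_
  rw [← transOp_mul, one_mul]

theorem transOp_mulOp {χ : AddChar F Circle} (hχ : Continuous χ) (ν : Measure (SymN F))
    [SMulInvariantMeasure (GLInf F) (SymN F) ν] (g : GLInf F) (A : SymInf F) (ξ : Lp ℂ 2 ν) :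
    transOp ν g (mulOp hχ ν A ξ) =
      mulOp hχ ν (g • Multiplicative.ofAdd A).toAdd (transOp ν g ξ) := by
  ext1
  filter_upwards [coeFn_transOp ν g (mulOp hχ ν A ξ),
    coeFn_mulOp hχ ν (g • Multiplicative.ofAdd A).toAdd (transOp ν g ξ), coeFn_transOp ν g ξ,
    (measurePreserving_smul_symN ν g.transpose).quasiMeasurePreserving.ae
      (coeFn_mulOp hχ ν A ξ)] with S h1 h2 h3 h4
  rw [h1, h2, h3, h4, pairing_smul]

/-- A family of linear isometries indexed by a group and compatible with the group law consists of
unitary operators. -/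
def unitaryHom {G H : Type*} [Group G] [NormedAddCommGroup H] [InnerProductSpace ℂ H]
    (f : G → H →ₗᵢ[ℂ] H) (h1 : ∀ v, f 1 v = v) (hmul : ∀ x y v, f (x * y) v = f x (f y v)) :
    G →* (H ≃ₗᵢ[ℂ] H) where
  toFun x :=
    { toLinearEquiv := LinearEquiv.ofLinearMap (f x).toLinearMap (f x⁻¹).toLinearMap
        (LinearMap.ext fun v => by
          change f x (f x⁻¹ v) = v
          rw [← hmul, mul_inv_cancel, h1])
        (LinearMap.ext fun v => by
          change f x⁻¹ (f x v) = v
          rw [← hmul, inv_mul_cancel, h1])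
      norm_map' := (f x).norm_map }
  map_one' := LinearIsometryEquiv.ext h1
  map_mul' x y := LinearIsometryEquiv.ext (hmul x y)

/-- The representation `ρ_ν` of `Sym(∞, F) ⋊ GL(∞, 𝒪)` in `L²(Sym(ℕ, F), ν)` given by
`(ρ(A) ξ)(S) = χ(tr(A S)) ξ(S)` and `(ρ(g) ξ)(S) = ξ(gᵗ S g)`, so that
`ρ(A, g) = ρ(A) ρ(g)`. -/
def rhoNu {χ : AddChar F Circle} (hχ : Continuous χ) (ν : Measure (SymN F))
    [SMulInvariantMeasure (GLInf F) (SymN F) ν] :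
    MotionGroup F →* (Lp ℂ 2 ν ≃ₗᵢ[ℂ] Lp ℂ 2 ν) :=
  SemidirectProduct.lift
    (unitaryHom (fun A : Multiplicative (SymInf F) => mulOp hχ ν A.toAdd)
      (mulOp_zero hχ ν) (fun A B => mulOp_add hχ ν A.toAdd B.toAdd))
    (unitaryHom (transOp ν) (transOp_one ν) (transOp_mul ν))
    (fun g => MonoidHom.ext fun A => by
      simp only [MonoidHom.comp_apply, MulEquiv.coe_toMonoidHom, MulAut.conj_apply]
      rw [eq_mul_inv_iff_mul_eq]
      exact LinearIsometryEquiv.ext fun ξ => (transOp_mulOp hχ ν g A.toAdd ξ).symm)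

theorem coeFn_rhoNu {χ : AddChar F Circle} (hχ : Continuous χ) (ν : Measure (SymN F))
    [SMulInvariantMeasure (GLInf F) (SymN F) ν] (A : SymInf F) (g : GLInf F) (ξ : Lp ℂ 2 ν) :
    rhoNu hχ ν (MotionGroup.mk A g) ξ =ᵐ[ν]
      fun S => (χ (pairing A S) : ℂ) * ξ (g.transpose • S) := by
  filter_upwards [coeFn_mulOp hχ ν A (transOp ν g ξ), coeFn_transOp ν g ξ] with S h1 h2
  rw [← h2]
  exact h1

end Representations

end CartanMotion

end

set_option linter.unusedSectionVars false

noncomputable section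

namespace CartanMotion

open Filter Topology Set
open scoped BoundedContinuousFunction ComplexConjugate

/-! ### Topology of `Sym(ℕ, F)` and of the compact groups `GL(n, 𝒪)` -/

section Topology

variable {F : Type*} [NontriviallyNormedField F] [IsUltrametricDist F]

/-! The correspondence is Fourier duality between `Sym(∞, F)` and `Sym(ℕ, F)`, with the constant
function `1` in `L²(ν)` playing the role of the spherical vector. In the code this vector is `charL
hχ ν 0`.

From measures to representations: the orbit of `1` consists of the functions `S ↦ χ(tr(AS))`, which
are total because a finite measure is determined by its Fourier transform (`measure_ext_of_charB`,
`span_charL_dense`). Thus `1` is cyclic. Ergodicity says that the invariant vectors are the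
constants. The projection onto an invariant closed subspace commutes with the group, so it
multiplies `1` by a scalar, hence is that scalar everywhere, and the subspace is trivial
(`irreducible_of_cyclic`). Ergodicity concerns strictly invariant sets, while `L²` only sees
invariance up to null sets; averaging over the compact groups `GL(n, 𝒪)` bridges the gap
(`IsErgodicProb.measure_eq_zero_or`).

Uniqueness: a unitary equivalence sends `1` to an invariant vector, hence to `c · 1` with `|c| = 1`,
so the two measures have the same Fourier transform.

From representations to measures: for an invariant unit vector `v` the function `A ↦ ⟨v, ρ(A)v⟩` has
to be written as the Fourier transform of a measure on `Sym(ℕ, F)`. Gelfand duality and the Riesz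
theorem give a measure on a compact space of possibly discontinuous characters of `Sym(∞, F)`
(`exists_spectral_measure`). Continuity of `ρ` shows that along each matrix entry almost every such
character is trivial on a small ball (`measure_nontrivial_le`), so by self-duality of `F` it is `a ↦
χ(as)` (`exists_char_eq`). Doing this for the countably many entries yields a random symmetric
matrix, whose law is `ν` (`exists_measure_fourier`). Equality of Gram matrices then identifies `ρ`
with `ρ_ν`, and irreducibility forces ergodicity. -/

theorem isClosed_symSubgroup : IsClosed (symSubgroup F : Set (Matrix ℕ ℕ F)) :=
  isClosed_eq (continuous_id.matrix_transpose) continuous_id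

theorem continuous_symN_apply (i j : ℕ) : Continuous fun S : SymN F => S.1 i j :=
  continuous_subtype_val.matrix_elem i j

theorem properSpace_field [LocallyCompactSpace F] : ProperSpace F :=
  ProperSpace.of_locallyCompactSpace F

instance polishSpace_symN [LocallyCompactSpace F] : PolishSpace (SymN F) := by
  have := properSpace_field (F := F)
  have : PolishSpace (Matrix ℕ ℕ F) := inferInstanceAs (PolishSpace (ℕ → ℕ → F))
  exact isClosed_symSubgroup.polishSpace

/-- A map into `Sym(ℕ, F)` is measurable as soon as preimages of closed sets under the matrix
entries are measurable. -/
theorem measurable_symN [LocallyCompactSpace F] {X : Type*} [MeasurableSpace X] {f : X → SymN F}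
    (hf : ∀ i j, ∀ C : Set F, IsClosed C → MeasurableSet {x | (f x).1 i j ∈ C}) :
    Measurable f := by
  have := properSpace_field (F := F)
  -- No σ-algebra on `F` is part of the statement, so measurability of the entries is phrased with
  -- closed sets and the Borel structure is introduced only here.
  let : MeasurableSpace F := borel F
  have : BorelSpace F := ⟨rfl⟩
  let e : SymN F → (ℕ → ℕ → F) := fun S i j => S.1 i j
  have h1 : Measurable (e ∘ f) :=
    measurable_pi_iff.2 fun i => measurable_pi_iff.2 fun j => measurable_of_isClosed (hf i j)
  have h2 : Topology.IsClosedEmbedding e :=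
    isClosed_symSubgroup.isClosedEmbedding_subtypeVal
  exact h2.measurableEmbedding.measurable_comp_iff.1 h1

instance compactSpace_intRing [LocallyCompactSpace F] : CompactSpace (IntRing F) := by
  have := properSpace_field (F := F)
  have h : ((IntRing F : Subring F) : Set F) = Metric.closedBall 0 1 := by
    ext x
    simp [Valuation.mem_integer_iff, NormedField.valuation_apply]
    rfl
  exact isCompact_iff_compactSpace.1 (h ▸ isCompact_closedBall (0 : F) 1)

instance compactSpace_GL [LocallyCompactSpace F] (n : ℕ) :
    CompactSpace (GL (Fin n) (IntRing F)) := by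
  have : CompactSpace (Matrix (Fin n) (Fin n) (IntRing F)) :=
    inferInstanceAs (CompactSpace (Fin n → Fin n → IntRing F))
  infer_instance

/-- Supplies the first countability that dominated convergence requires of the parameter space in
`continuous_rhoNu`. -/
instance secondCountable_GL [LocallyCompactSpace F] (n : ℕ) :
    SecondCountableTopology (GL (Fin n) (IntRing F)) := by
  have := properSpace_field (F := F)
  have : SecondCountableTopology (Matrix (Fin n) (Fin n) (IntRing F)) :=
    inferInstanceAs (SecondCountableTopology (Fin n → Fin n → IntRing F))
  have : SecondCountableTopology (Matrix (Fin n) (Fin n) (IntRing F))ᵐᵒᵖ :=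
    MulOpposite.opHomeomorph.symm.isEmbedding.secondCountableTopology
  exact Units.isEmbedding_embedProduct.secondCountableTopology

variable (F) in
/-- The embedding of `GL(n, 𝒪)` into `GL(∞, 𝒪)`. -/
def cornerGL (n : ℕ) : GL (Fin n) (IntRing F) →* GLInf F := Units.map (extendHom n)

theorem cornerGL_mat {n : ℕ} (k : GL (Fin n) (IntRing F)) (i j : ℕ) :
    (cornerGL F n k).mat i j = if h : i < n ∧ j < n then (k.1 ⟨i, h.1⟩ ⟨j, h.2⟩ : F)
      else (1 : Matrix ℕ ℕ F) i j := by
  change ((extendOne n k.1 i j : IntRing F) : F) = _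
  unfold extendOne
  split_ifs
  · rfl
  · by_cases h : i = j <;> simp [Matrix.one_apply, h]

theorem isOneOutside_cornerGL {n : ℕ} (k : GL (Fin n) (IntRing F)) :
    IsOneOutside n (cornerGL F n k).mat := fun i j hij => by
  rw [cornerGL_mat, dif_neg (by omega)]

/-- The corner must contain both `g` and `g⁻¹`, hence the maximum of two bounds. Membership in all
later corners is what allows arguments along `n → ∞`. -/
theorem exists_cornerGL_eq (g : GLInf F) : ∃ N, ∀ n ≥ N, ∃ k, cornerGL F n k = g := by
  obtain ⟨n1, h1⟩ := g.val.2
  obtain ⟨n2, h2⟩ := g.inv.2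
  refine ⟨max n1 n2, fun n hn => ?_⟩
  have hc : ∀ A : FinMat (IntRing F), IsOneOutside n A.1 →
      extendHom n (Matrix.of fun i j : Fin n => A.1 i j) = A := fun A hA => by
    refine Subtype.ext (Matrix.ext fun i j => ?_)
    change (extendOne n (Matrix.of fun i j : Fin n => A.1 i j) i j : IntRing F) = _
    unfold extendOne
    split_ifs with h
    · rfl
    · rw [hA i j (by omega)]
  have hinj : Function.Injective (extendHom (R := IntRing F) n) := fun a b hab => by
    ext i j
    have := congrFun (congrFun (congrArg Subtype.val hab) i) j
    change extendOne n a i j = extendOne n b i j at this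
    unfold extendOne at this
    simp only [i.2, j.2, and_self, dite_true] at this
    exact congrArg _ this
  have e1 := hc g.val (h1.mono ((le_max_left _ _).trans hn))
  have e2 := hc g.inv (h2.mono ((le_max_right _ _).trans hn))
  refine ⟨⟨Matrix.of fun i j : Fin n => g.val.1 i j, Matrix.of fun i j : Fin n => g.inv.1 i j,
    hinj ?_, hinj ?_⟩, ?_⟩
  · exact (map_mul _ _ _).trans ((congrArg₂ _ e1 e2).trans (g.val_inv.trans (map_one _).symm))
  · exact (map_mul _ _ _).trans ((congrArg₂ _ e2 e1).trans (g.inv_val.trans (map_one _).symm))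
  · exact Units.ext e1

theorem conjMat_apply {n m : ℕ} {g : GLInf F} (hg : IsOneOutside n g.mat) (S : Matrix ℕ ℕ F)
    {i j : ℕ} (hm : n ≤ m) (hi : i < m) (hj : j < m) :
    conjMat g S i j = ∑ l ∈ Finset.range m, (∑ k ∈ Finset.range m, g.mat i k * S k l) *
      g.mat j l := by
  have h0 : ∀ i < m, ∀ k, k ∉ Finset.range m → g.mat i k = 0 := fun i hi k hk => by
    have hk' : m ≤ k := by simpa using hk
    rw [hg i k (Or.inr (hm.trans hk')), Matrix.one_apply_ne (by omega)]
  rw [conjMat, ← Matrix.transpose_apply (infMul _ _) j i, infMul_transpose,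
    Matrix.transpose_transpose, infMul_apply_of_row _ i (h0 j hj)]
  refine Finset.sum_congr rfl fun l _ => ?_
  rw [Matrix.transpose_apply, infMul_apply_of_row _ l (h0 i hi), mul_comm]

theorem continuous_cornerGL_mat (n : ℕ) (i j : ℕ) :
    Continuous fun k : GL (Fin n) (IntRing F) => (cornerGL F n k).mat i j := by
  simp only [cornerGL_mat]
  split_ifs
  · exact continuous_subtype_val.comp (Units.continuous_val.matrix_elem _ _)
  · exact continuous_const

/-- The action of `GL(n, 𝒪)` on `Sym(ℕ, F)` is jointly continuous. -/
theorem continuous_cornerGL_smul (n : ℕ) :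
    Continuous fun p : GL (Fin n) (IntRing F) × SymN F => cornerGL F n p.1 • p.2 := by
  refine Continuous.subtype_mk (continuous_matrix fun i j => ?_) _
  set m := max n (max (i + 1) (j + 1)) with hm
  have h : ∀ p : GL (Fin n) (IntRing F) × SymN F, conjMat (cornerGL F n p.1) p.2.1 i j = _ :=
    fun p => conjMat_apply (m := m) (isOneOutside_cornerGL p.1) p.2.1 (by omega) (by omega)
      (by omega)
  simp only [h]
  refine continuous_finsetSum _ fun l _ => (continuous_finsetSum _ fun k _ => ?_).mul ?_
  · exact ((continuous_cornerGL_mat n i k).comp continuous_fst).mul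
      ((continuous_symN_apply k l).comp continuous_snd)
  · exact (continuous_cornerGL_mat n j l).comp continuous_fst

/-- Transposition preserves the corner and is continuous on units, since it acts continuously on the
matrix and on its inverse. -/
theorem continuous_transpose_cornerGL_smul (n : ℕ) :
    Continuous fun p : GL (Fin n) (IntRing F) × SymN F =>
      (cornerGL F n p.1).transpose • p.2 := by
  have h1 : ∀ k : GL (Fin n) (IntRing F), ∃ k', cornerGL F n k' = (cornerGL F n k).transpose ∧
      k'.1 = k.1.transpose ∧ k'.2 = k.2.transpose := fun k => by
    refine ⟨⟨k.1.transpose, k.2.transpose, ?_, ?_⟩, ?_, rfl, rfl⟩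
    · rw [← Matrix.transpose_mul, k.inv_val, Matrix.transpose_one]
    · rw [← Matrix.transpose_mul, k.val_inv, Matrix.transpose_one]
    · refine GLInf.mat_injective ?_
      ext i j
      rw [GLInf.mat_transpose, Matrix.transpose_apply, cornerGL_mat, cornerGL_mat]
      by_cases h : i < n ∧ j < n
      · rw [dif_pos h, dif_pos h.symm]; rfl
      · rw [dif_neg h, dif_neg fun h' => h h'.symm, ← Matrix.transpose_apply 1,
          Matrix.transpose_one]
  choose t ht ht1 ht2 using h1
  have hc : Continuous t := by
    refine Units.continuous_iff.2 ⟨?_, ?_⟩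
    · exact (Units.continuous_val.matrix_transpose).congr fun k => (ht1 k).symm
    · exact (Units.continuous_coe_inv.matrix_transpose).congr fun k => (ht2 k).symm
  exact ((continuous_cornerGL_smul n).comp ((hc.comp continuous_fst).prodMk continuous_snd)).congr
    fun p => by simp only [Function.comp, ht]

end Topology

/-! ### Fourier analysis on `Sym(ℕ, F)` -/

section Characters

variable {F : Type*} [NontriviallyNormedField F] [IsUltrametricDist F]

/-- The symmetric matrix `a (E_ij + E_ji)`. -/
def symUnit (i j : ℕ) (a : F) : SymInf F :=
  ⟨Matrix.single i j a + Matrix.single j i a, by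
    refine ⟨?_, max (i + 1) (j + 1), fun k l hkl => ?_⟩
    · rw [Matrix.IsSymm, Matrix.transpose_add, Matrix.transpose_single, Matrix.transpose_single,
        add_comm]
    · rw [Matrix.add_apply, Matrix.single_apply_of_ne _ _ _ _ _ (by omega),
        Matrix.single_apply_of_ne _ _ _ _ _ (by omega), add_zero]⟩

theorem pairing_eq_sum {n : ℕ} {A : SymInf F} (hA : IsZeroOutside n A.1) (S : SymN F) :
    pairing A S = ∑ i ∈ Finset.range n, ∑ j ∈ Finset.range n, A.1 i j * S.1 i j := by
  rw [pairing, hA.infTrace_infMul]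
  simp only [S.2.apply]

/-- The factor `2` is uniform: for `i = j` the matrix `symUnit i i a` has entry `2a`. This is where
characteristic different from `2` enters. -/
theorem pairing_symUnit (i j : ℕ) (a : F) (S : SymN F) :
    pairing (symUnit i j a) S = 2 * (a * S.1 i j) := by
  have hz : IsZeroOutside (max (i + 1) (j + 1)) (symUnit i j a).1 := fun k l hkl => by
    change (Matrix.single i j a + Matrix.single j i a) k l = 0
    rw [Matrix.add_apply, Matrix.single_apply_of_ne _ _ _ _ _ (by omega),
        Matrix.single_apply_of_ne _ _ _ _ _ (by omega), add_zero]
  have h1 : ∀ {i j n : ℕ}, i < n → j < n → ∑ k ∈ Finset.range n, ∑ l ∈ Finset.range n,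
      Matrix.single i j a k l * S.1 k l = a * S.1 i j := fun {i j n} hi hj => by
    rw [Finset.sum_eq_single_of_mem i (Finset.mem_range.2 hi), Finset.sum_eq_single_of_mem j
      (Finset.mem_range.2 hj), Matrix.single_apply_same]
    · intro l _ hl
      rw [Matrix.single_apply_of_ne _ _ _ _ _ fun h => hl h.2.symm, zero_mul]
    · intro k _ hk
      refine Finset.sum_eq_zero fun l _ => ?_
      rw [Matrix.single_apply_of_ne _ _ _ _ _ fun h => hk h.1.symm, zero_mul]
  rw [pairing_eq_sum hz]
  change ∑ k ∈ _, ∑ l ∈ _, (Matrix.single i j a k l + Matrix.single j i a k l) * S.1 k l = _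
  simp only [add_mul, Finset.sum_add_distrib]
  rw [h1 (by omega) (by omega), h1 (by omega) (by omega), S.2.apply, two_mul]

theorem symUnit_add (i j : ℕ) (a b : F) :
    symUnit i j (a + b) = symUnit i j a + symUnit i j b := by
  refine Subtype.ext ?_
  change Matrix.single i j (a + b) + Matrix.single j i (a + b) =
    (Matrix.single i j a + Matrix.single j i a) + (Matrix.single i j b + Matrix.single j i b)
  rw [Matrix.single_add, Matrix.single_add]
  abel

theorem symUnit_comm (i j : ℕ) (a : F) : symUnit i j a = symUnit j i a :=
  Subtype.ext (add_comm _ _)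

/-- Every finite symmetric matrix is a sum of elementary ones. -/
theorem eq_sum_symUnit (h2 : (2 : F) ≠ 0) {n : ℕ} {A : SymInf F} (hA : IsZeroOutside n A.1) :
    A = ∑ i ∈ Finset.range n, ∑ j ∈ Finset.range n, symUnit i j (A.1 i j / 2) := by
  refine Subtype.ext (Matrix.ext fun k l => ?_)
  simp only [AddSubgroup.val_finsetSum, Matrix.sum_apply]
  change _ = ∑ i ∈ _, ∑ j ∈ _, (Matrix.single i j (A.1 i j / 2) + Matrix.single j i (A.1 i j / 2))
    k l
  have hsum : ∀ k l, ∑ i ∈ Finset.range n, ∑ j ∈ Finset.range n,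
      Matrix.single i j (A.1 i j / 2) k l = A.1 k l / 2 := fun k l => by
    by_cases hk : k < n ∧ l < n
    · rw [Finset.sum_eq_single_of_mem k (Finset.mem_range.2 hk.1), Finset.sum_eq_single_of_mem l
        (Finset.mem_range.2 hk.2), Matrix.single_apply_same]
      · intro j _ hj
        rw [Matrix.single_apply_of_ne _ _ _ _ _ fun h => hj h.2]
      · intro i _ hi
        refine Finset.sum_eq_zero fun j _ => ?_
        rw [Matrix.single_apply_of_ne _ _ _ _ _ fun h => hi h.1]
    · rw [hA k l (by omega), zero_div]
      refine Finset.sum_eq_zero fun i hi => Finset.sum_eq_zero fun j hj => ?_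
      rw [Finset.mem_range] at hi hj
      rw [Matrix.single_apply_of_ne _ _ _ _ _ (by omega)]
  have hflip : ∀ i j : ℕ, ∀ a : F, Matrix.single j i a k l = Matrix.single i j a l k :=
    fun i j a => by
      rw [← Matrix.transpose_apply (Matrix.single i j a), Matrix.transpose_single]
  simp only [Matrix.add_apply, Finset.sum_add_distrib, hsum]
  have hflip' : ∑ i ∈ Finset.range n, ∑ j ∈ Finset.range n,
      Matrix.single j i (A.1 i j / 2) k l = A.1 l k / 2 :=
    (Finset.sum_congr rfl fun i _ => Finset.sum_congr rfl fun j _ => hflip i j _).trans (hsum l k)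
  rw [hflip', A.2.1.apply]
  field_simp
  ring

variable {χ : AddChar F Circle}

/-- The function `S ↦ χ(tr(A S))` on `Sym(ℕ, F)`. -/
def charB (hχ : Continuous χ) (A : SymInf F) : SymN F →ᵇ ℂ :=
  BoundedContinuousFunction.ofNormedAddCommGroup (fun S => (χ (pairing A S) : ℂ))
    ((by fun_prop : Continuous fun z : Circle => (z : ℂ)).comp (hχ.comp (continuous_pairing A)))
    1 fun S => (Circle.norm_coe _).le

theorem charB_apply (hχ : Continuous χ) (A : SymInf F) (S : SymN F) :
    charB hχ A S = χ (pairing A S) := rfl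

theorem pairing_zero (S : SymN F) : pairing 0 S = 0 := by
  have := pairing_add 0 0 S
  rw [add_zero] at this
  exact left_eq_add.1 this

theorem pairing_neg (A : SymInf F) (S : SymN F) : pairing (-A) S = -pairing A S := by
  have := pairing_add (-A) A S
  rw [neg_add_cancel, pairing_zero] at this
  exact eq_neg_of_add_eq_zero_left this.symm

theorem charB_zero (hχ : Continuous χ) : charB (F := F) hχ 0 = 1 := by
  ext S
  simp [charB_apply, pairing_zero]

theorem charB_add (hχ : Continuous χ) (A B : SymInf F) :
    charB hχ (A + B) = charB hχ A * charB hχ B := by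
  ext S
  simp [charB_apply, pairing_add, AddChar.map_add_eq_mul]

theorem charB_neg (hχ : Continuous χ) (A : SymInf F) : charB hχ (-A) = star (charB hχ A) := by
  ext S
  simp [charB_apply, pairing_neg, AddChar.map_neg_eq_inv, ← Circle.coe_inv_eq_conj]

/-- Trigonometric polynomials on `Sym(ℕ, F)`. -/
def trigPoly (hχ : Continuous χ) : StarSubalgebra ℂ (SymN F →ᵇ ℂ) where
  carrier := Submodule.span ℂ (range (charB hχ))
  mul_mem' {f g} hf hg := by
    induction hf, hg using Submodule.span_induction₂ with
    | mem_mem f g hf hg =>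
      obtain ⟨A, rfl⟩ := hf
      obtain ⟨B, rfl⟩ := hg
      exact charB_add hχ A B ▸ Submodule.subset_span (mem_range_self _)
    | zero_left g hg => simp
    | zero_right f hf => simp
    | add_left f f' g _ _ _ h h' => rw [add_mul]; exact add_mem h h'
    | add_right f g g' _ _ _ h h' => rw [mul_add]; exact add_mem h h'
    | smul_left c f g _ _ h => rw [smul_mul_assoc]; exact Submodule.smul_mem _ c h
    | smul_right c f g _ _ h => rw [mul_smul_comm]; exact Submodule.smul_mem _ c h
  add_mem' := fun hf hg => add_mem hf hg
  algebraMap_mem' c := by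
    rw [Algebra.algebraMap_eq_smul_one, ← charB_zero hχ]
    exact Submodule.smul_mem _ c (Submodule.subset_span (mem_range_self _))
  star_mem' {f} hf := by
    change f ∈ Submodule.span ℂ (range (charB hχ)) at hf
    change star f ∈ Submodule.span ℂ (range (charB hχ))
    induction hf using Submodule.span_induction with
    | mem f hf =>
      obtain ⟨A, rfl⟩ := hf
      exact charB_neg hχ A ▸ Submodule.subset_span (mem_range_self _)
    | zero => simp
    | add f g _ _ h h' => rw [star_add]; exact add_mem h h'
    | smul c f _ h => rw [star_smul]; exact Submodule.smul_mem _ _ h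

/-- If the `(i, j)` entries differ, a multiple of `E_ij + E_ji` can be scaled so that the two
pairings differ by an `a` with `χ(a) ≠ 1`. -/
theorem charB_separates (h2 : (2 : F) ≠ 0) (hχ : Continuous χ) (hχ1 : χ ≠ 1) {S T : SymN F}
    (h : ∀ A, charB hχ A S = charB hχ A T) : S = T := by
  refine Subtype.ext (Matrix.ext fun i j => ?_)
  by_contra hne
  obtain ⟨a, ha⟩ := AddChar.ne_one_iff.1 hχ1
  have hd : 2 * (S.1 i j - T.1 i j) ≠ 0 := mul_ne_zero h2 (sub_ne_zero.2 hne)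
  have h3 := h (symUnit i j (a / (2 * (S.1 i j - T.1 i j))))
  rw [charB_apply, charB_apply, Circle.coe_inj, pairing_symUnit, pairing_symUnit] at h3
  refine ha ?_
  rw [← div_eq_one, ← AddChar.map_sub_eq_div] at h3
  convert h3 using 2
  field_simp

variable [LocallyCompactSpace F]

/-- A finite measure on `Sym(ℕ, F)` is determined by its Fourier transform. -/
theorem measure_ext_of_charB (h2 : (2 : F) ≠ 0) (hχ : Continuous χ) (hχ1 : χ ≠ 1)
    {μ ν : Measure (SymN F)} [IsFiniteMeasure μ] [IsFiniteMeasure ν]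
    (h : ∀ A, ∫ S, charB hχ A S ∂μ = ∫ S, charB hχ A S ∂ν) : μ = ν := by
  refine ext_of_forall_mem_subalgebra_integral_eq_of_polish (𝕜 := ℂ) (A := trigPoly hχ) ?_ ?_
  · intro S T hST
    by_contra hcon
    refine hST (charB_separates h2 hχ hχ1 fun A => ?_)
    by_contra hA
    refine hcon ⟨_, ⟨(charB hχ A).toContinuousMap, ?_, rfl⟩, hA⟩
    exact ⟨charB hχ A, Submodule.subset_span (mem_range_self A), rfl⟩
  · intro g hg
    change g ∈ Submodule.span ℂ (range (charB hχ)) at hg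
    induction hg using Submodule.span_induction with
    | mem f hf => obtain ⟨A, rfl⟩ := hf; exact h A
    | zero => simp
    | add f g _ _ hf hg =>
      simp only [BoundedContinuousFunction.coe_add, Pi.add_apply]
      rw [integral_add (f.integrable _) (g.integrable _), integral_add (f.integrable _)
        (g.integrable _), hf, hg]
    | smul c f _ hf =>
      simp only [BoundedContinuousFunction.coe_smul]
      rw [integral_smul, integral_smul, hf]

/-- The function `S ↦ χ(tr(A S))` as an element of `L²`. -/
def charL (hχ : Continuous χ) (ν : Measure (SymN F)) [IsFiniteMeasure ν] (A : SymInf F) :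
    Lp ℂ 2 ν := (charB hχ A).toLp 2 ν ℂ

/-- The positive and negative parts of `h` are densities of two finite measures with the same
Fourier transform. The measures coincide, so the two parts agree almost everywhere and `h` vanishes.
-/
theorem ae_eq_zero_of_integral_charB (h2 : (2 : F) ≠ 0) (hχ : Continuous χ) (hχ1 : χ ≠ 1)
    {ν : Measure (SymN F)} [IsFiniteMeasure ν] {h : SymN F → ℝ} (hi : Integrable h ν)
    (h0 : ∀ A, ∫ S, (h S : ℂ) * charB hχ A S ∂ν = 0) : h =ᵐ[ν] 0 := by
  have hm : AEMeasurable h ν := hi.aestronglyMeasurable.aemeasurable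
  have hfin : ∀ f : SymN F → ℝ, Integrable f ν →
      IsFiniteMeasure (ν.withDensity fun S => ENNReal.ofReal (f S)) := fun f hf =>
    isFiniteMeasure_withDensity_ofReal hf.2
  have hmn : AEMeasurable (fun S => -h S) ν := hm.neg
  have hin : Integrable (fun S => -h S) ν := hi.neg
  have := hfin h hi
  have := hfin (fun S => -h S) hin
  have hint : ∀ f : SymN F → ℝ, AEMeasurable f ν → ∀ A,
      ∫ S, charB hχ A S ∂(ν.withDensity fun S => ENNReal.ofReal (f S)) =
        ∫ S, ((max (f S) 0 : ℝ) : ℂ) * charB hχ A S ∂ν := fun f hf A => by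
    rw [integral_withDensity_eq_integral_toReal_smul₀ hf.ennreal_ofReal
      (Eventually.of_forall fun S => ENNReal.ofReal_lt_top)]
    simp only [ENNReal.toReal_ofReal', Complex.real_smul]
  have hib : ∀ f : SymN F → ℝ, Integrable f ν → ∀ A,
      Integrable (fun S => (f S : ℂ) * charB hχ A S) ν := fun f hf A =>
    hf.ofReal.mul_bdd (c := 1) (charB hχ A).continuous.aestronglyMeasurable
      (Eventually.of_forall fun S => (Circle.norm_coe _).le)
  have heq : (ν.withDensity fun S => ENNReal.ofReal (h S)) =
      ν.withDensity fun S => ENNReal.ofReal (-h S) := by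
    refine measure_ext_of_charB h2 hχ hχ1 fun A => ?_
    rw [hint _ hm, hint _ hmn, ← sub_eq_zero, ← integral_sub (hib _ hi.pos_part A)
      (hib _ hin.pos_part A), ← h0 A]
    refine integral_congr_ae (Eventually.of_forall fun S => ?_)
    simp only [← sub_mul, ← Complex.ofReal_sub]
    rw [max_zero_sub_eq_self]
  rw [withDensity_eq_iff hm.ennreal_ofReal hmn.ennreal_ofReal] at heq
  · filter_upwards [heq] with S hS
    have h1 := congrArg ENNReal.toReal hS
    rw [ENNReal.toReal_ofReal', ENNReal.toReal_ofReal'] at h1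
    have := max_zero_sub_eq_self (h S)
    rw [h1, sub_self] at this
    exact this.symm
  · exact hi.lintegral_lt_top.ne

theorem inner_charL (hχ : Continuous χ) (ν : Measure (SymN F)) [IsFiniteMeasure ν] (A : SymInf F)
    (f : Lp ℂ 2 ν) : inner ℂ (charL hχ ν A) f = ∫ S, f S * charB hχ (-A) S ∂ν := by
  rw [L2.inner_def]
  refine integral_congr_ae ?_
  filter_upwards [BoundedContinuousFunction.coeFn_toLp (p := 2) (𝕜 := ℂ) ν (charB hχ A)] with S hS
  rw [charL, hS, charB_neg]
  rfl

/-- The functions `S ↦ χ(tr(A S))` span a dense subspace of `L²`. -/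
theorem span_charL_dense (h2 : (2 : F) ≠ 0) (hχ : Continuous χ) (hχ1 : χ ≠ 1)
    (ν : Measure (SymN F)) [IsFiniteMeasure ν] :
    (Submodule.span ℂ (range (charL hχ ν))).topologicalClosure = ⊤ := by
  rw [Submodule.topologicalClosure_eq_top_iff, Submodule.eq_bot_iff]
  intro f hf
  have h0 : ∀ A, ∫ S, f S * charB hχ A S ∂ν = 0 := fun A => by
    rw [← neg_neg A, ← inner_charL]
    exact hf _ (Submodule.subset_span (mem_range_self _))
  have hi : Integrable f ν := (Lp.memLp f).integrable one_le_two
  have hib : ∀ f : SymN F → ℂ, Integrable f ν → ∀ A,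
      Integrable (fun S => f S * charB hχ A S) ν := fun f hf A =>
    hf.mul_bdd (c := 1) (charB hχ A).continuous.aestronglyMeasurable
      (Eventually.of_forall fun S => (Circle.norm_coe _).le)
  -- The characters are closed under conjugation, so `conj f` is orthogonal to them as well. This
  -- reduces the claim to the real and imaginary parts of `f`.
  have h1 : ∀ A, ∫ S, conj (f S) * charB hχ A S ∂ν = 0 := fun A => by
    have h3 := congrArg conj (h0 (-A))
    rw [← integral_conj, map_zero, charB_neg] at h3
    simpa using h3
  have hci : Integrable (fun S => conj (f S)) ν := by
    refine (integrable_norm_iff ?_).1 ?_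
    · exact Complex.continuous_conj.comp_aestronglyMeasurable hi.1
    · simpa using hi.norm
  have hre : (fun S => (f S).re) =ᵐ[ν] 0 := by
    refine ae_eq_zero_of_integral_charB h2 hχ hχ1 hi.re fun A => ?_
    have : ∀ S, ((f S).re : ℂ) * charB hχ A S =
        (1 / 2 : ℂ) * (f S * charB hχ A S + conj (f S) * charB hχ A S) := fun S => by
      rw [Complex.re_eq_add_conj]; ring
    simp only [this]
    rw [integral_const_mul, integral_add (hib _ hi A) (hib _ hci A), h0, h1]
    simp
  have him : (fun S => (f S).im) =ᵐ[ν] 0 := by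
    refine ae_eq_zero_of_integral_charB h2 hχ hχ1 hi.im fun A => ?_
    have : ∀ S, ((f S).im : ℂ) * charB hχ A S =
        (1 / (2 * Complex.I) : ℂ) * (f S * charB hχ A S - conj (f S) * charB hχ A S) := fun S => by
      rw [Complex.im_eq_sub_conj]; ring
    simp only [this]
    rw [integral_const_mul, integral_sub (hib _ hi A) (hib _ hci A), h0, h1]
    simp
  refine (Lp.eq_zero_iff_ae_eq_zero).2 ?_
  filter_upwards [hre, him] with S h3 h4
  exact Complex.ext h3 h4

end Characters

/-! ### Almost invariant sets and functions for an ergodic measure -/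

section Ergodicity

variable {F : Type*} [NontriviallyNormedField F] [IsUltrametricDist F] [LocallyCompactSpace F]

/-- A Borel set which is invariant up to null sets agrees, up to a null set, with a Borel set which
is strictly invariant under `GL(n, 𝒪)`. -/
theorem exists_cornerGL_invariant {ν : Measure (SymN F)} [IsFiniteMeasure ν] {B : Set (SymN F)}
    (hB : MeasurableSet B) (hinv : ∀ g : GLInf F, ∀ᵐ S ∂ν, g • S ∈ B ↔ S ∈ B) (n : ℕ) :
    ∃ B' : Set (SymN F), MeasurableSet B' ∧ (∀ᵐ S ∂ν, S ∈ B' ↔ S ∈ B) ∧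
      ∀ k S, cornerGL F n k • S ∈ B' ↔ S ∈ B' := by
  let : MeasurableSpace (GL (Fin n) (IntRing F)) := borel _
  have : BorelSpace (GL (Fin n) (IntRing F)) := ⟨rfl⟩
  let μ : Measure (GL (Fin n) (IntRing F)) := Measure.haar
  have hact : Measurable fun p : SymN F × GL (Fin n) (IntRing F) => cornerGL F n p.2⁻¹ • p.1 :=
    ((continuous_cornerGL_smul n).comp
      ((continuous_inv.comp continuous_snd).prodMk continuous_fst)).measurable
  -- `B'` consists of the points with Haar-almost all translates in `B`. Fubini shows that it
  -- differs from `B` by a null set. The inverse on `k` turns translation by `h` into left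
  -- multiplication by `h⁻¹`, under which Haar measure is invariant.
  refine ⟨{S | ∀ᵐ k ∂μ, cornerGL F n k⁻¹ • S ∈ B}, ?_, ?_, fun h S => ?_⟩
  · have h1 : Measurable fun S => μ (Prod.mk S ⁻¹'
        ((fun p : SymN F × GL (Fin n) (IntRing F) => cornerGL F n p.2⁻¹ • p.1) ⁻¹' Bᶜ)) :=
      measurable_measure_prodMk_left (hact hB.compl)
    exact h1 (measurableSet_singleton 0)
  · have h1 : ∀ᵐ S ∂ν, ∀ᵐ k ∂μ, cornerGL F n k⁻¹ • S ∈ B ↔ S ∈ B := by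
      refine (Measure.ae_ae_comm ?_).2 (Eventually.of_forall fun k => hinv _)
      exact (hact hB).iff (measurable_fst hB)
    filter_upwards [h1] with S hS
    constructor
    · intro hS'
      obtain ⟨k, hk, hk'⟩ := (hS.and hS').exists
      exact hk.1 hk'
    · intro hS'
      exact hS.mono fun k hk => hk.2 hS'
  · change (∀ᵐ k ∂μ, cornerGL F n k⁻¹ • cornerGL F n h • S ∈ B) ↔ _
    have h1 : ∀ k, cornerGL F n k⁻¹ • cornerGL F n h • S = cornerGL F n (h⁻¹ * k)⁻¹ • S :=
      fun k => by rw [← mul_smul, ← map_mul, mul_inv_rev, inv_inv]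
    simp only [h1]
    exact eventually_mul_left_iff μ h⁻¹ (p := fun k => cornerGL F n k⁻¹ • S ∈ B)

/-- For an ergodic measure, Borel sets which are invariant up to null sets are trivial. -/
theorem IsErgodicProb.measure_eq_zero_or {ν : Measure (SymN F)} (hν : IsErgodicProb ν)
    {B : Set (SymN F)} (hB : MeasurableSet B)
    (hinv : ∀ g : GLInf F, ∀ᵐ S ∂ν, g • S ∈ B ↔ S ∈ B) : ν B = 0 ∨ ν Bᶜ = 0 := by
  have := hν.isProb
  choose B' hm hae hi using exists_cornerGL_invariant hB hinv
  -- The lower limit depends only on the tail of the sequence, and every `g` lies in all `GL(n, 𝒪)`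
  -- with `n` large. Hence `C` is strictly invariant under the whole group.
  let C : Set (SymN F) := {S | ∀ᶠ n in atTop, S ∈ B' n}
  have hC : MeasurableSet C := by
    have : C = ⋃ N, ⋂ n, ⋂ (_ : N ≤ n), B' n := by
      ext S
      simp [C, eventually_atTop]
    rw [this]
    exact MeasurableSet.iUnion fun N => MeasurableSet.iInter fun n =>
      MeasurableSet.iInter fun _ => hm n
  have hCB : ∀ᵐ S ∂ν, S ∈ C ↔ S ∈ B := by
    filter_upwards [ae_all_iff.2 hae] with S hS
    simp only [C, mem_ofPred_eq, hS, eventually_const]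
  have hCinv : ∀ g : GLInf F, (fun S => g • S) ⁻¹' C = C := fun g => by
    obtain ⟨N, hN⟩ := exists_cornerGL_eq g
    ext S
    refine eventually_congr (eventually_atTop.2 ⟨N, fun n hn => ?_⟩)
    obtain ⟨k, rfl⟩ := hN n hn
    exact hi n k S
  have hCB' : C =ᵐ[ν] B := hCB.mono fun S hS => propext hS
  rw [← measure_congr hCB', ← measure_congr hCB'.compl]
  exact hν.ergodic C hC hCinv

/-- For an ergodic measure, functions which are invariant up to null sets are constant. -/
theorem IsErgodicProb.ae_eq_const {ν : Measure (SymN F)} (hν : IsErgodicProb ν)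
    {f : SymN F → ℂ} (hf : AEStronglyMeasurable f ν)
    (hinv : ∀ g : GLInf F, (fun S => f (g • S)) =ᵐ[ν] f) : ∃ c : ℂ, f =ᵐ[ν] fun _ => c := by
  have := hν.isProb
  have := hν.invariant
  have hq : ∀ g : GLInf F, Measure.QuasiMeasurePreserving (fun S : SymN F => g • S) ν ν :=
    fun g => (measurePreserving_smul_symN ν g).quasiMeasurePreserving
  obtain ⟨f', hf', hff'⟩ := hf.aemeasurable
  have hinv' : ∀ g : GLInf F, ∀ᵐ S ∂ν, f' (g • S) = f' S := fun g => by
    filter_upwards [hinv g, hff', (hq g).ae hff'] with S h1 h2 h3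
    rw [← h2, ← h3, h1]
  have h1 : ∀ U : Set ℂ, MeasurableSet U → (∀ᵐ S ∂ν, f' S ∈ U) ∨ ∀ᵐ S ∂ν, f' S ∉ U := fun U hU => by
    rcases hν.measure_eq_zero_or (hf' hU) fun g => (hinv' g).mono fun S hS => by
      simp only [mem_preimage, hS] with h | h
    · exact Or.inr (by simp only [ae_iff, not_not]; exact h)
    · exact Or.inl (by rw [ae_iff]; exact h)
  -- Countably many measurable sets separate the points of `ℂ`, so the zero-one alternative for
  -- their preimages makes `f'` constant almost everywhere.
  obtain ⟨c, hc⟩ := exists_eventuallyEq_const_of_forall_separating (l := ae ν) (f := f')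
    MeasurableSet h1
  exact ⟨c, hff'.trans hc⟩

end Ergodicity

/-! ### A criterion for irreducibility -/

section AbstractRepresentations

variable {G H : Type*} [Group G] [NormedAddCommGroup H] [InnerProductSpace ℂ H]

theorem rep_mul_apply (ρ : G →* (H ≃ₗᵢ[ℂ] H)) (x y : G) (v : H) :
    ρ (x * y) v = ρ x (ρ y v) := by rw [map_mul]; rfl

theorem inner_rep_left (ρ : G →* (H ≃ₗᵢ[ℂ] H)) (x : G) (u w : H) :
    inner ℂ (ρ x u) w = inner ℂ u (ρ x⁻¹ w) := by
  rw [← (ρ x⁻¹).inner_map_map, ← rep_mul_apply, inv_mul_cancel, map_one]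
  rfl

/-- A cyclic vector whose image under every intertwining operator is proportional to itself
generates an irreducible representation. -/
theorem irreducible_of_cyclic [CompleteSpace H] (ρ : G →* (H ≃ₗᵢ[ℂ] H)) (v : H)
    (hv : (Submodule.span ℂ (range fun x => ρ x v)).topologicalClosure = ⊤)
    (hP : ∀ P : H →L[ℂ] H, (∀ x u, P (ρ x u) = ρ x (P u)) → ∃ c : ℂ, P v = c • v)
    (W : Submodule ℂ H) (hW : IsClosed (W : Set H)) (hinv : ∀ x, ∀ u ∈ W, ρ x u ∈ W) :
    W = ⊥ ∨ W = ⊤ := by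
  have : CompleteSpace W := hW.completeSpace_coe
  -- Invariance of `W` under inverses makes the orthogonal complement invariant too, so `P` is an
  -- intertwining operator. It is scalar on the orbit of `v`, hence everywhere by cyclicity, and a
  -- scalar projection is `0` or `1`.
  let P : H →L[ℂ] H := W.starProjection
  have hcomm : ∀ x u, P (ρ x u) = ρ x (P u) := fun x u => by
    refine Submodule.eq_starProjection_of_mem_of_inner_eq_zero
      (hinv x _ (Submodule.starProjection_apply_mem _ _)) fun w hw => ?_
    rw [← map_sub, inner_rep_left]
    exact Submodule.starProjection_inner_eq_zero _ _ (hinv _ _ hw)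
  obtain ⟨c, hc⟩ := hP P hcomm
  have hPc : ∀ u, P u = c • u := fun u => by
    have hu : u ∈ (Submodule.span ℂ (range fun x => ρ x v)).topologicalClosure := hv ▸ trivial
    have hcl : IsClosed {u : H | P u = c • u} :=
      isClosed_eq P.continuous (continuous_const_smul c)
    refine hcl.closure_subset_iff.2 (fun w hw => ?_) hu
    induction hw using Submodule.span_induction with
    | mem w hw =>
      obtain ⟨x, rfl⟩ := hw
      change P (ρ x v) = c • ρ x v
      rw [hcomm, hc, map_smul]
    | zero => simp
    | add w w' _ _ h h' =>
      change P w = c • w at h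
      change P w' = c • w' at h'
      change P (w + w') = c • (w + w')
      rw [map_add, h, h', smul_add]
    | smul d w _ h =>
      change P w = c • w at h
      change P (d • w) = c • d • w
      rw [map_smul, h, smul_comm]
  by_cases hc0 : c = 0
  · left
    refine (Submodule.eq_bot_iff _).2 fun w hw => ?_
    rw [← (Submodule.starProjection_eq_self_iff (K := W)).2 hw]
    exact (hPc w).trans (by rw [hc0, zero_smul])
  · right
    refine (Submodule.eq_top_iff').2 fun u => ?_
    have : c • u ∈ W := hPc u ▸ Submodule.starProjection_apply_mem _ _
    simpa [smul_smul, hc0] using W.smul_mem c⁻¹ this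

end AbstractRepresentations

/-! ### The representation `ρ_ν` is spherical -/

section RhoNu

variable {F : Type*} [NontriviallyNormedField F] [IsUltrametricDist F] [LocallyCompactSpace F]
  {χ : AddChar F Circle} (hχ : Continuous χ) (ν : Measure (SymN F)) [IsFiniteMeasure ν]

theorem coeFn_charL (A : SymInf F) : charL hχ ν A =ᵐ[ν] fun S => (χ (pairing A S) : ℂ) :=
  BoundedContinuousFunction.coeFn_toLp (p := 2) (𝕜 := ℂ) ν (charB hχ A)

variable [SMulInvariantMeasure (GLInf F) (SymN F) ν]

theorem rhoNu_charL (A B : SymInf F) (g : GLInf F) :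
    rhoNu hχ ν (MotionGroup.mk A g) (charL hχ ν B) =
      charL hχ ν (A + (g • Multiplicative.ofAdd B).toAdd) := by
  ext1
  filter_upwards [coeFn_rhoNu hχ ν A g (charL hχ ν B),
    coeFn_charL hχ ν (A + (g • Multiplicative.ofAdd B).toAdd),
    (measurePreserving_smul_symN ν g.transpose).quasiMeasurePreserving.ae (coeFn_charL hχ ν B)]
    with S h1 h2 h3
  rw [h1, h2, h3, pairing_add, pairing_smul, AddChar.map_add_eq_mul, Circle.coe_mul]

theorem rhoNu_charL_zero (A : SymInf F) (g : GLInf F) :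
    rhoNu hχ ν (MotionGroup.mk A g) (charL hχ ν 0) = charL hχ ν A := by
  rw [rhoNu_charL, ofAdd_zero, smul_one, toAdd_one, add_zero]

/-- Joint continuity of the action makes `k ↦ (S ↦ kᵗ S k)` continuous for the compact-open
topology, and composition in `L²` is continuous along such families of measure preserving maps. -/
theorem continuous_transOp (n : ℕ) (ξ : Lp ℂ 2 ν) :
    Continuous fun k : GL (Fin n) (IntRing F) => transOp ν (cornerGL F n k) ξ := by
  have hc : Continuous fun k : GL (Fin n) (IntRing F) =>
      (⟨fun S => (cornerGL F n k).transpose • S, continuous_smul_symN _⟩ : C(SymN F, SymN F)) :=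
    ContinuousMap.continuous_of_continuous_uncurry _ (continuous_transpose_cornerGL_smul n)
  exact Continuous.compMeasurePreservingLp (continuous_const (y := ξ)) hc
    (fun k => measurePreserving_smul_symN ν _) (by simp)

-- For isometries weak continuity gives strong continuity: the squared distance of two images of `ξ`
-- is `2‖ξ‖²` minus twice the real part of their inner product. That inner product is continuous by
-- dominated convergence with bound `‖ξ S‖ ^ 2`.
omit [SMulInvariantMeasure (GLInf F) (SymN F) ν] in
theorem continuous_mulOp {Z : Type*} [TopologicalSpace Z] [FirstCountableTopology Z]
    {A : Z → SymInf F} (hA : ∀ S, Continuous fun z => pairing (A z) S) (ξ : Lp ℂ 2 ν) :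
    Continuous fun z => mulOp hχ ν (A z) ξ := by
  refine continuous_iff_continuousAt.2 fun z₀ => ?_
  have hco : Continuous fun z : Circle => (z : ℂ) := by fun_prop
  have hint : Continuous fun z => inner ℂ (mulOp hχ ν (A z₀) ξ) (mulOp hχ ν (A z) ξ) := by
    have h1 : ∀ z, inner ℂ (mulOp hχ ν (A z₀) ξ) (mulOp hχ ν (A z) ξ) =
        ∫ S, (χ (pairing (A z) S) : ℂ) * conj (χ (pairing (A z₀) S) : ℂ) * (ξ S * conj (ξ S)) ∂ν := by
      intro z
      rw [L2.inner_def]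
      refine integral_congr_ae ?_
      filter_upwards [coeFn_mulOp hχ ν (A z₀) ξ, coeFn_mulOp hχ ν (A z) ξ] with S h1 h2
      rw [h1, h2]
      simp only [RCLike.inner_apply, map_mul]
      ring
    simp only [h1]
    have hc : ∀ A : SymInf F, Continuous fun S : SymN F => (χ (pairing A S) : ℂ) :=
      fun A => hco.comp (hχ.comp (continuous_pairing A))
    refine continuous_of_dominated (bound := fun S => ‖ξ S‖ ^ 2) (fun z => ?_)
      (fun z => Eventually.of_forall fun S => ?_) ?_ (Eventually.of_forall fun S => ?_)
    · refine AEStronglyMeasurable.mul ?_ ((Lp.aestronglyMeasurable ξ).mul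
        (Complex.continuous_conj.comp_aestronglyMeasurable (Lp.aestronglyMeasurable ξ)))
      exact ((hc _).mul (Complex.continuous_conj.comp (hc _))).aestronglyMeasurable
    · simp only [norm_mul, Circle.norm_coe, RCLike.norm_conj, one_mul, sq, le_refl]
    · exact (Lp.memLp ξ).integrable_norm_pow (by norm_num)
    · exact ((hco.comp (hχ.comp (hA S))).mul continuous_const).mul continuous_const
  have hnorm : ∀ z, ‖mulOp hχ ν (A z) ξ - mulOp hχ ν (A z₀) ξ‖ ^ 2 =
      2 * ‖ξ‖ ^ 2 - 2 * (inner ℂ (mulOp hχ ν (A z₀) ξ) (mulOp hχ ν (A z) ξ)).re := fun z => by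
    rw [norm_sub_rev, norm_sub_sq (𝕜 := ℂ), LinearIsometry.norm_map, LinearIsometry.norm_map]
    simp only [RCLike.re_to_complex]
    ring
  have hz0 := hnorm z₀
  rw [sub_self, norm_zero] at hz0
  rw [ContinuousAt, tendsto_iff_norm_sub_tendsto_zero]
  have hsq : Tendsto (fun z => ‖mulOp hχ ν (A z) ξ - mulOp hχ ν (A z₀) ξ‖ ^ 2) (𝓝 z₀) (𝓝 0) := by
    simp only [hnorm]
    have h2 : Continuous fun z => 2 * ‖ξ‖ ^ 2 -
        2 * (inner ℂ (mulOp hχ ν (A z₀) ξ) (mulOp hχ ν (A z) ξ)).re := by fun_prop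
    have h3 := h2.tendsto z₀
    rwa [← hz0, zero_pow two_ne_zero] at h3
  have h4 := (Real.continuous_sqrt.tendsto 0).comp hsq
  simpa [Function.comp_def, Real.sqrt_sq] using h4

/-- In the inductive limit topology continuity is tested on each stage. There `ρ(A)ρ(g)ξ` is
`ρ(A)ρ(g₀)ξ` plus `ρ(A)` applied to `ρ(g)ξ - ρ(g₀)ξ`; as `ρ(A)` is isometric, the error tends to
zero regardless of how `A` varies. -/
theorem continuous_rhoNu (ξ : Lp ℂ 2 ν) : Continuous fun x => rhoNu hχ ν x ξ := by
  have := properSpace_field (F := F)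
  refine continuous_iSup_dom.2 fun n => continuous_coinduced_dom.2 ?_
  have : SecondCountableTopology (Matrix (Fin n) (Fin n) F) :=
    inferInstanceAs (SecondCountableTopology (Fin n → Fin n → F))
  have : SecondCountableTopology {a : Matrix (Fin n) (Fin n) F // a.IsSymm} :=
    Topology.IsEmbedding.subtypeVal.secondCountableTopology
  let A : {a : Matrix (Fin n) (Fin n) F // a.IsSymm} × GL (Fin n) (IntRing F) → SymInf F :=
    fun p => (MotionGroup.stage n p).left.toAdd
  have hA : ∀ S, Continuous fun p => pairing (A p) S := fun S => by
    have h1 : ∀ p, pairing (A p) S = ∑ i ∈ Finset.range n, ∑ j ∈ Finset.range n,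
        extendZero n p.1.1 i j * S.1 i j :=
      fun p => pairing_eq_sum (isZeroOutside_extendZero n p.1.1) S
    simp only [h1]
    refine continuous_finsetSum _ fun i _ => continuous_finsetSum _ fun j _ =>
      Continuous.mul ?_ continuous_const
    unfold extendZero
    split_ifs
    · exact (continuous_subtype_val.comp continuous_fst).matrix_elem _ _
    · exact continuous_const
  refine continuous_iff_continuousAt.2 fun p₀ => ?_
  have h1 : Tendsto (fun p => mulOp hχ ν (A p) (transOp ν (cornerGL F n p₀.2) ξ)) (𝓝 p₀)
      (𝓝 (mulOp hχ ν (A p₀) (transOp ν (cornerGL F n p₀.2) ξ))) :=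
    (continuous_mulOp hχ ν hA _).tendsto p₀
  have h2 : Tendsto (fun p : {a : Matrix (Fin n) (Fin n) F // a.IsSymm} × GL (Fin n) (IntRing F) =>
      mulOp hχ ν (A p) (transOp ν (cornerGL F n p.2) ξ - transOp ν (cornerGL F n p₀.2) ξ))
      (𝓝 p₀) (𝓝 0) := by
    rw [tendsto_zero_iff_norm_tendsto_zero]
    simp only [LinearIsometry.norm_map]
    exact tendsto_iff_norm_sub_tendsto_zero.1
      (((continuous_transOp ν n ξ).comp continuous_snd).tendsto p₀)
  have h3 := h1.add h2
  rw [add_zero] at h3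
  refine h3.congr fun p => ?_
  rw [← map_add, add_sub_cancel]
  rfl

/-- An invariant vector is a function invariant up to null sets, hence constant by ergodicity, and
`charL hχ ν 0` is the constant function `1`. -/
theorem exists_eq_smul_charL_zero (hν : IsErgodicProb ν) {ξ : Lp ℂ 2 ν}
    (h : ∀ g : GLInf F, rhoNu hχ ν (MotionGroup.mk 0 g) ξ = ξ) : ∃ c : ℂ, ξ = c • charL hχ ν 0 := by
  obtain ⟨c, hc⟩ := hν.ae_eq_const (Lp.aestronglyMeasurable ξ) fun g => by
    -- The group acts on functions through transposes, so `gᵗ` is the element whose operator is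
    -- composition with `S ↦ g • S`.
    have h1 := coeFn_rhoNu hχ ν 0 g.transpose ξ
    rw [h] at h1
    filter_upwards [h1] with S hS
    rw [hS, pairing_zero, AddChar.map_zero_eq_one, Circle.coe_one, one_mul]
    rfl
  refine ⟨c, ?_⟩
  ext1
  filter_upwards [hc, coeFn_charL hχ ν 0, Lp.coeFn_smul c (charL hχ ν 0)] with S h1 h2 h3
  rw [h1, h3, Pi.smul_apply, h2, pairing_zero, AddChar.map_zero_eq_one, Circle.coe_one,
    smul_eq_mul, mul_one]

theorem inner_charL_charL (A B : SymInf F) :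
    inner ℂ (charL hχ ν A) (charL hχ ν B) = ∫ S, charB hχ (B - A) S ∂ν := by
  rw [inner_charL]
  refine integral_congr_ae ?_
  filter_upwards [coeFn_charL hχ ν B] with S hS
  rw [hS, sub_eq_add_neg, charB_add]
  rfl

theorem charL_zero_ne_zero [NeZero ν] : charL hχ ν 0 ≠ 0 := fun h => by
  have h1 := inner_charL_charL hχ ν 0 0
  rw [h, inner_zero_left, sub_zero, charB_zero] at h1
  simp only [BoundedContinuousFunction.coe_one, Pi.one_apply, integral_const, Complex.real_smul,
    mul_one] at h1
  exact (measureReal_univ_pos (μ := ν)).ne (Complex.ofReal_injective h1)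

theorem span_orbit_charL_dense (h2 : (2 : F) ≠ 0) (hχ1 : χ ≠ 1) :
    (Submodule.span ℂ (range fun x => rhoNu hχ ν x (charL hχ ν 0))).topologicalClosure = ⊤ := by
  refine top_unique ((span_charL_dense h2 hχ hχ1 ν).ge.trans
    (Submodule.topologicalClosure_mono (Submodule.span_mono ?_)))
  rintro _ ⟨A, rfl⟩
  exact ⟨MotionGroup.mk A 1, rhoNu_charL_zero hχ ν A 1⟩

/-- The function `1` is cyclic, and an intertwining operator maps it to an invariant vector, that
is, to a multiple of `1`. -/
theorem isSpherical_rhoNu (h2 : (2 : F) ≠ 0) (hχ1 : χ ≠ 1) (hν : IsErgodicProb ν) :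
    IsSpherical (rhoNu hχ ν) where
  continuous := continuous_rhoNu hχ ν
  irreducible := irreducible_of_cyclic _ (charL hχ ν 0) (span_orbit_charL_dense hχ ν h2 hχ1)
    fun P hP => exists_eq_smul_charL_zero hχ ν hν fun g => by rw [← hP, rhoNu_charL_zero]
  exists_invariant := by
    have := hν.isProb
    exact ⟨charL hχ ν 0, charL_zero_ne_zero hχ ν, fun g => rhoNu_charL_zero hχ ν 0 g⟩

end RhoNu

/-! ### The measure is determined by the representation -/

section Uniqueness

variable {F : Type*} [NontriviallyNormedField F] [IsUltrametricDist F] [LocallyCompactSpace F]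
  {χ : AddChar F Circle} (hχ : Continuous χ)

/-- The equivalence carries `1` to an invariant vector of the second representation, hence to `c ·
1`. Comparing matrix coefficients, the Fourier transforms agree up to the factor `|c|²`, and the
value at `A = 0` shows that this factor is `1`. -/
theorem measure_eq_of_unitarilyEquivalent (h2 : (2 : F) ≠ 0) (hχ1 : χ ≠ 1)
    (ν ν' : Measure (SymN F)) [IsProbabilityMeasure ν] [IsProbabilityMeasure ν']
    [SMulInvariantMeasure (GLInf F) (SymN F) ν] [SMulInvariantMeasure (GLInf F) (SymN F) ν']
    (hν' : IsErgodicProb ν')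
    (h : UnitarilyEquivalent (rhoNu hχ ν) (rhoNu hχ ν')) : ν = ν' := by
  obtain ⟨U, hU⟩ := h
  obtain ⟨c, hc⟩ := exists_eq_smul_charL_zero hχ ν' hν' (ξ := U (charL hχ ν 0)) fun g => by
    rw [← hU, rhoNu_charL_zero]
  have key : ∀ A, ∫ S, charB hχ A S ∂ν = (conj c * c) * ∫ S, charB hχ A S ∂ν' := fun A => by
    have h1 := inner_charL_charL hχ ν 0 A
    have h2 := inner_charL_charL hχ ν' 0 A
    rw [sub_zero] at h1 h2
    rw [← h1, ← h2, ← U.inner_map_map, ← rhoNu_charL_zero hχ ν A 1, hU, hc, map_smul,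
      rhoNu_charL_zero, inner_smul_left, inner_smul_right, mul_assoc]
  have hc1 : conj c * c = 1 := by
    have := key 0
    simpa [charB_zero] using this.symm
  exact measure_ext_of_charB h2 hχ hχ1 fun A => by rw [key A, hc1, one_mul]

end Uniqueness

/-! ### Spectral measures by Gelfand duality and the Riesz theorem -/

section SpectralMeasure

/-- A real valued continuous function, regarded as complex valued. -/
def complexify {X : Type*} [TopologicalSpace X] (f : C(X, ℝ)) : C(X, ℂ) :=
  ⟨fun x => (f x : ℂ), by fun_prop⟩

open WeakDual in
/-- Positive functionals on a commutative C⋆-algebra are given by integration over the space of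
characters. -/
theorem exists_regular_measure_of_positive {A : Type*} [CommCStarAlgebra A]
    [MeasurableSpace (characterSpace ℂ A)] [BorelSpace (characterSpace ℂ A)] (Λ : A →ₗ[ℂ] ℂ)
    (hΛ : ∀ a, ∃ r : ℝ, 0 ≤ r ∧ Λ (star a * a) = r) :
    ∃ μ : Measure (characterSpace ℂ A), μ.Regular ∧ IsFiniteMeasure μ ∧
      ∀ a, Λ a = ∫ x, x a ∂μ := by
  let X := characterSpace ℂ A
  let G := gelfandStarTransform A
  have hG : ∀ a (x : X), G a x = x a := fun a x => rfl
  let L : C(X, ℝ) → ℂ := fun f => Λ (G.symm (complexify f))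
  have hadd : ∀ f g, L (f + g) = L f + L g := fun f g => by
    have : complexify (f + g) = complexify f + complexify g := by
      ext x; simp [complexify]
    simp only [L, this, map_add]
  have hsmul : ∀ (c : ℝ) f, L (c • f) = (c : ℂ) * L f := fun c f => by
    have : complexify (c • f) = (c : ℂ) • complexify f := by
      ext x; simp [complexify]
    simp only [L, this, map_smul, smul_eq_mul]
  have hpos : ∀ f : C(X, ℝ), 0 ≤ f → ∃ r : ℝ, 0 ≤ r ∧ L f = r := fun f hf => by
    -- A nonnegative `f` equals `star g * g` with `g = √f`, which turns positivity of `Λ` on such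
    -- products into positivity on functions.
    let g : C(X, ℝ) := ⟨fun x => √(f x), by fun_prop⟩
    obtain ⟨r, hr, h⟩ := hΛ (G.symm (complexify g))
    refine ⟨r, hr, ?_⟩
    rw [← h, ← map_star, ← map_mul]
    change Λ _ = Λ _
    congr 2
    ext x
    simp only [complexify, ContinuousMap.mul_apply, ContinuousMap.star_apply, ContinuousMap.coe_mk,
      g, RCLike.star_def, Complex.conj_ofReal, ← Complex.ofReal_mul]
    exact congrArg _ (Real.mul_self_sqrt (hf x)).symm
  -- A real function is the difference of two nonnegative ones, so `L` is real on it and passing to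
  -- real parts in `Φ` loses nothing.
  have hreal : ∀ f, L f = (L f).re := fun f => by
    obtain ⟨r, -, hr⟩ := hpos f⁺ (posPart_nonneg f)
    obtain ⟨s, -, hs⟩ := hpos f⁻ (negPart_nonneg f)
    have h1 : L f = (r : ℂ) + (-1 : ℝ) * s := by
      rw [← hr, ← hs, ← hsmul, ← hadd]
      congr 1
      rw [neg_one_smul, ← sub_eq_add_neg, posPart_sub_negPart]
    rw [h1]
    simp
  let Φ : CompactlySupportedContinuousMap X ℝ →ₚ[ℝ] ℝ := PositiveLinearMap.mk₀
    { toFun := fun f => (L f.toContinuousMap).re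
      map_add' := fun f g => by rw [← Complex.add_re, ← hadd]; rfl
      map_smul' := fun c f => by
        have := hsmul c f.toContinuousMap
        rw [RingHom.id_apply, smul_eq_mul, ← Complex.re_ofReal_mul, ← this]
        rfl } fun f hf => by
      obtain ⟨r, hr, h⟩ := hpos f.toContinuousMap fun x => hf x
      change 0 ≤ (L f.toContinuousMap).re
      rw [h]
      exact hr
  refine ⟨RealRMK.rieszMeasure Φ, inferInstance, inferInstance, fun a => ?_⟩
  have hint : ∀ f : C(X, ℝ), L f = ((∫ x, f x ∂(RealRMK.rieszMeasure Φ) : ℝ) : ℂ) := fun f => by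
    have := RealRMK.integral_rieszMeasure Φ ⟨f, HasCompactSupport.of_compactSpace _⟩
    rw [hreal]
    exact congrArg _ this.symm
  let u : C(X, ℝ) := ⟨fun x => (G a x).re, by fun_prop⟩
  let v : C(X, ℝ) := ⟨fun x => (G a x).im, by fun_prop⟩
  have ha : a = G.symm (complexify u) + Complex.I • G.symm (complexify v) := by
    have h1 : G a = complexify u + Complex.I • complexify v := by
      ext x
      simp only [complexify, ContinuousMap.add_apply, ContinuousMap.smul_apply,
        ContinuousMap.coe_mk, u, v, smul_eq_mul]
      rw [mul_comm, Complex.re_add_im]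
    rw [← map_smul, ← map_add, ← h1, StarAlgEquiv.symm_apply_apply]
  have h1 : Λ a = L u + Complex.I * L v := by
    conv_lhs => rw [ha, map_add, map_smul, smul_eq_mul]
  have hiu : ∀ f : C(X, ℝ), Integrable f (RealRMK.rieszMeasure Φ) := fun f =>
    f.continuous.integrable_of_hasCompactSupport (HasCompactSupport.of_compactSpace _)
  rw [h1, hint, hint, ← integral_complex_ofReal, ← integral_complex_ofReal, ← integral_const_mul,
    ← integral_add (hiu u).ofReal ((hiu v).ofReal.const_mul _)]
  refine integral_congr_ae (Eventually.of_forall fun x => ?_)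
  change ((G a x).re : ℂ) + Complex.I * ((G a x).im : ℂ) = x a
  rw [mul_comm, Complex.re_add_im, hG]

universe u v

variable {D : Type u} {H : Type v} [AddCommGroup D] [NormedAddCommGroup H] [InnerProductSpace ℂ H]
  [CompleteSpace H]

/-- The spectral measure of a vector for a unitary representation of a commutative group. -/
theorem exists_spectral_measure (π : Multiplicative D →* (H ≃ₗᵢ[ℂ] H)) (v : H) :
    ∃ (X : Type v) (_ : TopologicalSpace X) (_ : CompactSpace X) (_ : T2Space X)
      (_ : MeasurableSpace X) (_ : BorelSpace X) (μ : Measure X) (e : X → AddChar D Circle),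
      μ.Regular ∧ IsFiniteMeasure μ ∧ (∀ d, Continuous fun x => e x d) ∧
      ∀ d, ∫ x, (e x d : ℂ) ∂μ = inner ℂ v (π (Multiplicative.ofAdd d) v) := by
  let T : D → (H →L[ℂ] H) := fun d => (π (Multiplicative.ofAdd d)).toContinuousLinearEquiv
  have hTa : ∀ d w, T d w = π (Multiplicative.ofAdd d) w := fun d w => rfl
  have hTmul : ∀ a b, T (a + b) = T a * T b := fun a b => by
    ext w
    rw [hTa, ofAdd_add, rep_mul_apply]
    rfl
  have hT0 : T 0 = 1 := by
    ext w
    rw [hTa, ofAdd_zero, map_one]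
    rfl
  have hTstar : ∀ d, star (T d) = T (-d) := fun d => by
    rw [ContinuousLinearMap.star_eq_adjoint, eq_comm, ContinuousLinearMap.eq_adjoint_iff]
    intro x y
    rw [hTa, hTa, inner_rep_left, ofAdd_neg, inv_inv]
  -- The operators `T d` commute and their adjoints are the `T (-d)`, so the closed algebra they
  -- generate is a commutative C⋆-algebra. Each point of its compact character space restricts to a
  -- character of `D`.
  let S₀ : StarSubalgebra ℂ (H →L[ℂ] H) := StarAlgebra.adjoin ℂ (range T)
  have hcomm : ∀ a b, T a * T b = T b * T a := fun a b => by rw [← hTmul, ← hTmul, add_comm]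
  have hS₀ : ∀ x y : S₀, x * y = y * x := by
    have : IsMulCommutative S₀ := StarAlgebra.isMulCommutative_adjoin ℂ
      (by rintro _ ⟨a, rfl⟩ _ ⟨b, rfl⟩; exact hcomm a b)
      (by rintro _ ⟨a, rfl⟩ _ ⟨b, rfl⟩; rw [hTstar]; exact hcomm a (-b))
    exact fun x y => this.is_comm.comm x y
  let S := S₀.topologicalClosure
  have hSc : IsClosed (S : Set (H →L[ℂ] H)) := S₀.isClosed_topologicalClosure
  let i1 : CStarAlgebra S := StarSubalgebra.cstarAlgebra S
  let i2 : CommCStarAlgebra S :=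
    { i1 with mul_comm := (StarSubalgebra.commRingTopologicalClosure S₀ hS₀).mul_comm }
  let X : Type _ := WeakDual.characterSpace ℂ S
  let i3 : MeasurableSpace X := borel X
  have i4 : BorelSpace X := ⟨rfl⟩
  let t : D → S := fun d => ⟨T d, S₀.le_topologicalClosure
    (StarAlgebra.subset_adjoin ℂ _ (mem_range_self d))⟩
  let Λ : S →ₗ[ℂ] ℂ :=
    { toFun := fun a => inner ℂ v ((a : H →L[ℂ] H) v)
      map_add' := fun a b => by
        rw [← inner_add_right]
        rfl
      map_smul' := fun c a => by
        rw [RingHom.id_apply, smul_eq_mul, ← inner_smul_right]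
        rfl }
  -- The functional `a ↦ ⟨v, a v⟩` is positive because its value at `a⋆a` is `‖a v‖²`.
  obtain ⟨μ, hreg, hfin, hμ⟩ := exists_regular_measure_of_positive Λ fun a =>
    ⟨‖(a : H →L[ℂ] H) v‖ ^ 2, by positivity, by
      change inner ℂ v ((star (a : H →L[ℂ] H) * (a : H →L[ℂ] H)) v) = _
      rw [mul_apply_eq_comp, ContinuousLinearMap.star_eq_adjoint,
        ContinuousLinearMap.adjoint_inner_right, inner_self_eq_norm_sq_to_K]
      simp⟩
  have ht0 : t 0 = 1 := Subtype.ext hT0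
  have htadd : ∀ a b, t (a + b) = t a * t b := fun a b => Subtype.ext (hTmul a b)
  have htstar : ∀ a, t (-a) = star (t a) := fun a => Subtype.ext (hTstar a).symm
  have hnorm : ∀ (x : X) d, x (t d) ∈ Submonoid.unitSphere ℂ := fun x d => by
    have h1 : x (t (-d)) * x (t d) = 1 := by
      rw [← map_mul, ← htadd, neg_add_cancel, ht0, map_one]
    rw [htstar, map_star, RCLike.star_def, Complex.conj_mul'] at h1
    have h2 : ‖x (t d)‖ ^ 2 = 1 := by exact_mod_cast h1
    exact mem_sphere_zero_iff_norm.2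
      ((pow_eq_one_iff_of_nonneg (norm_nonneg _) two_ne_zero).1 h2)
  refine ⟨X, inferInstance, inferInstance, inferInstance, i3, i4, μ, fun x =>
    { toFun := fun d => ⟨x (t d), hnorm x d⟩
      map_zero_eq_one' := Subtype.ext (by
        change x (t 0) = 1
        rw [ht0, map_one])
      map_add_eq_mul' := fun a b => Subtype.ext (by
        change x (t (a + b)) = x (t a) * x (t b)
        rw [htadd, map_mul]) }, hreg, hfin, fun d => ?_, fun d => ?_⟩
  · exact Continuous.subtype_mk (gelfandStarTransform S (t d)).continuous _
  · exact (hμ (t d)).symm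

end SpectralMeasure

/-! ### Self-duality of the field -/

section SelfDuality

variable {F : Type*} [NontriviallyNormedField F] [IsUltrametricDist F] {ϖ : F}
  {χ : AddChar F Circle}

theorem IsUniformizer.norm_lt_one (hϖ : IsUniformizer ϖ) : ‖ϖ‖ < 1 :=
  (hϖ ϖ).2 ⟨1, by simp, by simp⟩

theorem IsUniformizer.ne_zero (hϖ : IsUniformizer ϖ) : ϖ ≠ 0 := by
  rintro rfl
  obtain ⟨x, hx0, hx1⟩ := NormedField.exists_norm_lt_one F
  obtain ⟨y, -, hy⟩ := (hϖ x).1 hx1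
  rw [hy, zero_mul, norm_zero] at hx0
  exact lt_irrefl _ hx0

/-- The character `χ` of `F` has conductor `𝒪`. -/
theorem norm_le_one_of_char_trivial (hϖ : IsUniformizer ϖ)
    (hχn : ∃ x y : F, ‖x‖ ≤ 1 ∧ ‖y‖ ≤ 1 ∧ χ (ϖ⁻¹ * x) ≠ χ (ϖ⁻¹ * y)) {b : F}
    (hb : ∀ x : F, ‖x‖ ≤ 1 → χ (b * x) = 1) : ‖b‖ ≤ 1 := by
  by_contra! hb1
  have hb0 : b ≠ 0 := norm_pos_iff.1 (one_pos.trans hb1)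
  -- If `‖b‖ > 1`, then `b⁻¹` lies in `ϖ𝒪`, that is, `ϖ⁻¹` lies in `b𝒪`. Triviality on `b𝒪` would
  -- then contradict nontriviality on `ϖ⁻¹𝒪`.
  obtain ⟨y, hy, hby⟩ := (hϖ b⁻¹).1 (by rw [norm_inv]; exact inv_lt_one_of_one_lt₀ hb1)
  have hy' : ϖ⁻¹ = b * y := by
    have := hϖ.ne_zero
    field_simp at hby ⊢
    linear_combination hby
  have h1 : ∀ x : F, ‖x‖ ≤ 1 → χ (ϖ⁻¹ * x) = 1 := fun x hx => by
    rw [hy', mul_assoc]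
    exact hb _ (by rw [norm_mul]; exact mul_le_one₀ hy (norm_nonneg _) hx)
  obtain ⟨x, z, hx, hz, hne⟩ := hχn
  exact hne (by rw [h1 x hx, h1 z hz])

theorem eq_zero_of_char_trivial
    (hχn : ∃ x y : F, ‖x‖ ≤ 1 ∧ ‖y‖ ≤ 1 ∧ χ (ϖ⁻¹ * x) ≠ χ (ϖ⁻¹ * y)) {d : F}
    (hd : ∀ a : F, χ (a * d) = 1) : d = 0 := by
  by_contra hd0
  obtain ⟨x, y, -, -, hne⟩ := hχn
  have h : ∀ a, χ a = 1 := fun a => by simpa [hd0] using hd (a / d)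
  exact hne (by rw [h, h])

/-- The subgroup of `𝒪` given by a ball around the origin. -/
def ballSubgroup (F : Type*) [NontriviallyNormedField F] [IsUltrametricDist F] (r : ℝ)
    (hr : 0 ≤ r) : AddSubgroup (IntRing F) where
  carrier := {x | ‖(x : F)‖ ≤ r}
  add_mem' := fun {a b} ha hb => (IsUltrametricDist.norm_add_le_max (a : F) b).trans (max_le ha hb)
  zero_mem' := by simpa using hr
  neg_mem' := fun {a} ha => by simpa using ha

theorem isOpen_ballSubgroup {r : ℝ} (hr : 0 < r) :
    IsOpen (ballSubgroup F r hr.le : Set (IntRing F)) := by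
  have h := (IsUltrametricDist.isOpen_closedBall (0 : F) hr.ne').preimage
    (continuous_subtype_val (p := fun x => x ∈ IntRing F))
  convert h using 1
  ext x
  simp [ballSubgroup]

theorem mem_intRing {x : F} : x ∈ IntRing F ↔ ‖x‖ ≤ 1 := by
  rw [Valuation.mem_integer_iff, NormedField.valuation_apply]
  rfl

variable [LocallyCompactSpace F]

/-- The characters of the finite group `π⁻¹ 𝒪 / 𝒪` are given by elements of `𝒪`. -/
theorem exists_char_eq_on_ball (hϖ : IsUniformizer ϖ) (hχ1 : ∀ x : F, ‖x‖ ≤ 1 → χ x = 1)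
    (hχn : ∃ x y : F, ‖x‖ ≤ 1 ∧ ‖y‖ ≤ 1 ∧ χ (ϖ⁻¹ * x) ≠ χ (ϖ⁻¹ * y))
    {ψ : AddChar F Circle} (hψ : ∀ x : F, ‖x‖ ≤ 1 → ψ x = 1) {π : F} (hπ : π ≠ 0) :
    ∃ s : F, ‖s‖ ≤ 1 ∧ ∀ x : F, ‖x‖ ≤ 1 → ψ (π⁻¹ * x) = χ (π⁻¹ * x * s) := by
  have hπ0 : 0 < ‖π‖ := norm_pos_iff.2 hπ
  let K := ballSubgroup F ‖π‖ hπ0.le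
  have hdiv : ∀ x : IntRing F, x ∈ K → ‖π⁻¹ * x‖ ≤ 1 := fun x hx => by
    rw [norm_mul, norm_inv, inv_mul_le_one₀ hπ0]
    exact hx
  let Q := IntRing F ⧸ K
  -- An open subgroup of the compact group `𝒪` has finite index, so the surjectivity below becomes a
  -- count: a finite abelian group has as many characters as elements.
  have : Finite Q := AddSubgroup.quotient_finite_of_isOpen K (isOpen_ballSubgroup hπ0)
  have hlift : ∀ θ : AddChar F Circle, (∀ x : F, ‖x‖ ≤ 1 → θ x = 1) →
      ∃ θ' : AddChar Q Circle, ∀ x : IntRing F, θ' (x : Q) = θ (π⁻¹ * x) := fun θ hθ => by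
    let f : IntRing F →+ Additive Circle :=
      { toFun := fun x => Additive.ofMul (θ (π⁻¹ * x))
        map_zero' := by simp
        map_add' := fun x y => by
          simp [mul_add, AddChar.map_add_eq_mul] }
    have hf : K ≤ f.ker := fun x hx => by
      rw [AddMonoidHom.mem_ker]
      exact congrArg Additive.ofMul (hθ _ (hdiv x hx))
    exact ⟨AddChar.toAddMonoidHomEquiv.symm (QuotientAddGroup.lift K f hf), fun x => rfl⟩
  have hint : ∀ s : IntRing F, ‖(s : F)‖ ≤ 1 := fun s => mem_intRing.1 s.2
  have hmul : ∀ s : F, ∃ θ : AddChar F Circle, ∀ a, θ a = χ (a * s) := fun s =>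
    ⟨χ.compAddMonoidHom (AddMonoidHom.mulRight s), fun a => rfl⟩
  choose m hm using hmul
  have hm1 : ∀ s : IntRing F, ∀ x : F, ‖x‖ ≤ 1 → m s x = 1 := fun s x hx => by
    rw [hm]
    exact hχ1 _ (by rw [norm_mul]; exact mul_le_one₀ hx (norm_nonneg _) (hint s))
  choose Φ hΦ using fun s : IntRing F => hlift (m s) (hm1 s)
  -- Only injectivity and equality of cardinals are needed, so an arbitrary choice of
  -- representatives is enough.
  let Ψ : Q → AddChar Q Circle := fun q => Φ q.out
  have hinj : Function.Injective Ψ := fun q q' h => by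
    rw [← QuotientAddGroup.out_eq' q, ← QuotientAddGroup.out_eq' q']
    refine QuotientAddGroup.eq.2 ?_
    have h1 : ‖π⁻¹ * ((-q.out + q'.out : IntRing F) : F)‖ ≤ 1 := by
      refine norm_le_one_of_char_trivial hϖ hχn fun x hx => ?_
      have h2 := DFunLike.congr_fun h ((⟨x, mem_intRing.2 hx⟩ : IntRing F) : Q)
      simp only [Ψ, hΦ, hm] at h2
      have : π⁻¹ * ((-q.out + q'.out : IntRing F) : F) * x =
          π⁻¹ * x * (q'.out : IntRing F) - π⁻¹ * x * (q.out : IntRing F) := by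
        push_cast
        ring
      rw [this, AddChar.map_sub_eq_div, div_eq_one]
      exact h2.symm
    rw [norm_mul, norm_inv, inv_mul_le_one₀ hπ0] at h1
    exact h1
  have hcard : Nat.card Q = Nat.card (AddChar Q Circle) := by
    have := Fintype.ofFinite Q
    rw [Nat.card_congr AddChar.circleEquivComplex.toEquiv, Nat.card_eq_fintype_card,
      Nat.card_eq_fintype_card, AddChar.card_eq]
  have : Finite (AddChar Q Circle) := Nat.finite_of_card_ne_zero (hcard ▸ Nat.card_pos.ne')
  obtain ⟨ψ', hψ'⟩ := hlift ψ hψ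
  obtain ⟨q, hq⟩ := ((Nat.bijective_iff_injective_and_card Ψ).2 ⟨hinj, hcard⟩).2 ψ'
  refine ⟨(q.out : IntRing F), hint _, fun x hx => ?_⟩
  have h1 := hψ' ⟨x, mem_intRing.2 hx⟩
  rw [← h1, ← hq, hΦ, hm]

/-- For each `m` the elements `s` of `𝒪` that represent `ψ` on `ϖ⁻ᵐ𝒪` form a nonempty compact set,
and these sets decrease with `m`. A common point represents `ψ` on the union of the `ϖ⁻ᵐ𝒪`, which is
`F`. -/
theorem exists_char_eq_of_trivial_on_int (hϖ : IsUniformizer ϖ) (hχ : Continuous χ)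
    (hχ1 : ∀ x : F, ‖x‖ ≤ 1 → χ x = 1)
    (hχn : ∃ x y : F, ‖x‖ ≤ 1 ∧ ‖y‖ ≤ 1 ∧ χ (ϖ⁻¹ * x) ≠ χ (ϖ⁻¹ * y))
    {ψ : AddChar F Circle} (hψ : ∀ x : F, ‖x‖ ≤ 1 → ψ x = 1) :
    ∃ s : F, ∀ a, ψ a = χ (a * s) := by
  have := properSpace_field (F := F)
  have hϖ0 := hϖ.ne_zero
  let K : ℕ → Set F := fun m => {s | ‖s‖ ≤ 1 ∧
    ∀ x : F, ‖x‖ ≤ 1 → ψ ((ϖ ^ m)⁻¹ * x) = χ ((ϖ ^ m)⁻¹ * x * s)}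
  have hcl : ∀ m, IsClosed (K m) := fun m => by
    have h1 : K m = Metric.closedBall 0 1 ∩ ⋂ x : F, ⋂ (_ : ‖x‖ ≤ 1),
        {s | ψ ((ϖ ^ m)⁻¹ * x) = χ ((ϖ ^ m)⁻¹ * x * s)} := by
      ext s
      simp [K]
    rw [h1]
    refine Metric.isClosed_closedBall.inter (isClosed_iInter fun x => isClosed_iInter fun _ =>
      isClosed_eq continuous_const ?_)
    exact hχ.comp (continuous_const.mul continuous_id)
  have hK0 : IsCompact (K 0) :=
    (isCompact_closedBall (0 : F) 1).of_isClosed_subset (hcl 0) fun s hs => by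
      simpa using hs.1
  obtain ⟨s, hs⟩ := IsCompact.nonempty_iInter_of_sequence_nonempty_isCompact_isClosed K
    (fun m s hs => ⟨hs.1, fun x hx => by
      have h1 := hs.2 (ϖ * x) (by
        rw [norm_mul]; exact mul_le_one₀ hϖ.norm_lt_one.le (norm_nonneg _) hx)
      have h2 : (ϖ ^ (m + 1))⁻¹ * (ϖ * x) = (ϖ ^ m)⁻¹ * x := by field_simp; ring
      rwa [h2] at h1⟩)
    (fun m => exists_char_eq_on_ball hϖ hχ1 hχn hψ (pow_ne_zero m hϖ0)) hK0 hcl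
  refine ⟨s, fun a => ?_⟩
  have hlim : Tendsto (fun m => ‖ϖ‖ ^ m * ‖a‖) atTop (𝓝 0) := by
    simpa using (tendsto_pow_atTop_nhds_zero_of_lt_one (norm_nonneg ϖ) hϖ.norm_lt_one).mul_const ‖a‖
  obtain ⟨m, hm⟩ := (hlim.eventually (ge_mem_nhds one_pos)).exists
  have h1 := (mem_iInter.1 hs m).2 (ϖ ^ m * a) (by rwa [norm_mul, norm_pow])
  rwa [inv_mul_cancel_left₀ (pow_ne_zero m hϖ0)] at h1

/-- Every character of `F` which is trivial near the origin is of the form `a ↦ χ(a s)`. -/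
theorem exists_char_eq (hϖ : IsUniformizer ϖ) (hχ : Continuous χ)
    (hχ1 : ∀ x : F, ‖x‖ ≤ 1 → χ x = 1)
    (hχn : ∃ x y : F, ‖x‖ ≤ 1 ∧ ‖y‖ ≤ 1 ∧ χ (ϖ⁻¹ * x) ≠ χ (ϖ⁻¹ * y))
    {ψ : AddChar F Circle} {r : ℝ} (hr : 0 < r) (hψ : ∀ x : F, ‖x‖ ≤ r → ψ x = 1) :
    ∃ s : F, ∀ a, ψ a = χ (a * s) := by
  -- Scaling the argument by `c` with `‖c‖ < r` makes the character trivial on `𝒪`.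
  obtain ⟨c, hc0, hcr⟩ := NormedField.exists_norm_lt F hr
  have hc : c ≠ 0 := norm_pos_iff.1 hc0
  obtain ⟨s, hs⟩ := exists_char_eq_of_trivial_on_int hϖ hχ hχ1 hχn
    (ψ := ψ.compAddMonoidHom (AddMonoidHom.mulLeft c)) fun x hx => by
      refine hψ (c * x) ?_
      rw [norm_mul]
      exact (mul_le_of_le_one_right hc0.le hx).trans hcr.le
  refine ⟨c⁻¹ * s, fun a => ?_⟩
  have h1 : ψ (c * (c⁻¹ * a)) = χ (c⁻¹ * a * s) := hs (c⁻¹ * a)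
  rw [mul_inv_cancel_left₀ hc] at h1
  rw [h1]
  congr 1
  ring

end SelfDuality

/-! ### Random characters that are close to trivial on a subgroup -/

section RandomCharacters

/-- The geometric sums are bounded by `2 / ‖z - 1‖` unless `z = 1`. Applied to `z = e x a`, the
averages converge to the indicator of the event `e x a = 1`. -/
theorem tendsto_cesaro_pow {z : ℂ} (hz : ‖z‖ = 1) :
    Tendsto (fun N : ℕ => (N : ℂ)⁻¹ * ∑ n ∈ Finset.range N, z ^ n) atTop
      (𝓝 (if z = 1 then 1 else 0)) := by
  split_ifs with h
  · refine tendsto_const_nhds.congr' ?_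
    filter_upwards [eventually_ne_atTop 0] with N hN
    simp [h, hN]
  · refine (tendsto_inv_atTop_nhds_zero_nat (𝕜 := ℂ)).zero_mul_isBoundedUnder_le ?_
    refine isBoundedUnder_of ⟨2 / ‖z - 1‖, fun N => ?_⟩
    rw [Function.comp, geom_sum_eq h, norm_div]
    gcongr
    calc ‖z ^ N - 1‖ ≤ ‖z ^ N‖ + ‖(1 : ℂ)‖ := norm_sub_le _ _
      _ = 2 := by rw [norm_pow, hz]; norm_num

variable {X D : Type*} [MeasurableSpace X] [AddCommGroup D]
  {μ : Measure X} [IsFiniteMeasure μ] {e : X → AddChar D Circle}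

-- The indicator of `e x a = 1` is a limit of averages of `e x (n • a)`. Averaging the bound over
-- the elements `b + n • a`, which stay in `L`, therefore preserves it. The quantifier over all `b ∈
-- L` is what carries the induction on `t`.
open Classical in
theorem norm_integral_char_indicator_sub_le (he : ∀ d, Measurable fun x => (e x d : ℂ))
    (L : AddSubgroup D) {m : ℂ} {ε : ℝ} (hL : ∀ d ∈ L, ‖∫ x, (e x d : ℂ) ∂μ - m‖ ≤ ε)
    (t : Finset D) (ht : ∀ d ∈ t, d ∈ L) : ∀ b ∈ L,
      ‖∫ x, (e x b : ℂ) * (if ∀ d ∈ t, e x d = 1 then 1 else 0) ∂μ - m‖ ≤ ε := by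
  induction t using Finset.induction with
  | empty => simpa using hL
  | insert a t hat ih =>
    intro b hb
    have ha : a ∈ L := ht a (Finset.mem_insert_self _ _)
    replace ih := ih fun d hd => ht d (Finset.mem_insert_of_mem hd)
    have hmeas : ∀ d, Measurable fun x => (e x d : ℂ) * (if ∀ d ∈ t, e x d = 1 then 1 else 0) :=
      fun d => (he d).mul (Measurable.ite
        (by
          have : {x | ∀ d ∈ t, e x d = 1} = ⋂ d ∈ t, (fun x => (e x d : ℂ)) ⁻¹' {1} := by
            ext x; simp [Circle.coe_eq_one]
          change MeasurableSet {x | ∀ d ∈ t, e x d = 1}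
          rw [this]
          exact Finset.measurableSet_biInter t fun d _ => he d (measurableSet_singleton 1))
        measurable_const measurable_const)
    have hbd : ∀ d x, ‖(e x d : ℂ) * (if ∀ d ∈ t, e x d = 1 then 1 else 0)‖ ≤ 1 := fun d x => by
      rw [norm_mul, Circle.norm_coe, one_mul]
      split_ifs <;> simp
    have hint : ∀ d, Integrable
        (fun x => (e x d : ℂ) * (if ∀ d ∈ t, e x d = 1 then 1 else 0)) μ := fun d =>
      Integrable.of_bound (hmeas d).aestronglyMeasurable 1 (Eventually.of_forall (hbd d))
    have hsum : ∀ (N : ℕ) x, (N : ℂ)⁻¹ * ∑ n ∈ Finset.range N,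
          (e x (b + n • a) : ℂ) * (if ∀ d ∈ t, e x d = 1 then 1 else 0) =
        ((N : ℂ)⁻¹ * ∑ n ∈ Finset.range N, (e x a : ℂ) ^ n) *
          ((e x b : ℂ) * (if ∀ d ∈ t, e x d = 1 then 1 else 0)) := fun N x => by
      rw [mul_assoc, Finset.sum_mul]
      congr 1
      refine Finset.sum_congr rfl fun n _ => ?_
      rw [AddChar.map_add_eq_mul, AddChar.map_nsmul_eq_pow, Circle.coe_mul, Circle.coe_pow]
      ring
    have hlim : Tendsto (fun N : ℕ => ∫ x, (N : ℂ)⁻¹ * ∑ n ∈ Finset.range N,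
          (e x (b + n • a) : ℂ) * (if ∀ d ∈ t, e x d = 1 then 1 else 0) ∂μ) atTop
        (𝓝 (∫ x, (e x b : ℂ) * (if ∀ d ∈ insert a t, e x d = 1 then 1 else 0) ∂μ)) := by
      refine tendsto_integral_of_dominated_convergence (fun _ => 1) (fun N => ?_)
        (integrable_const _) (fun N => Eventually.of_forall fun x => ?_)
        (Eventually.of_forall fun x => ?_)
      · exact ((Finset.measurable_sum _ fun n _ => hmeas _).const_mul _).aestronglyMeasurable
      · rw [norm_mul, norm_inv, RCLike.norm_natCast]
        refine (mul_le_mul_of_nonneg_left (norm_sum_le_of_le _ fun n _ => hbd _ x)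
          (by positivity)).trans ?_
        rw [Finset.sum_const, Finset.card_range, nsmul_eq_mul, mul_one]
        exact inv_mul_le_one
      · simp only [hsum]
        have h1 := (tendsto_cesaro_pow (Circle.norm_coe (e x a))).mul_const
          ((e x b : ℂ) * (if ∀ d ∈ t, e x d = 1 then 1 else 0))
        convert h1 using 2
        by_cases hxa : e x a = 1 <;> simp [hxa, Circle.coe_eq_one]
    refine le_of_tendsto (hlim.sub_const m).norm ?_
    filter_upwards [eventually_ne_atTop 0] with N hN
    have hN' : (N : ℂ) ≠ 0 := Nat.cast_ne_zero.2 hN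
    have h2 : ∫ x, (N : ℂ)⁻¹ * ∑ n ∈ Finset.range N,
          (e x (b + n • a) : ℂ) * (if ∀ d ∈ t, e x d = 1 then 1 else 0) ∂μ - m =
        (N : ℂ)⁻¹ * ∑ n ∈ Finset.range N, (∫ x,
          (e x (b + n • a) : ℂ) * (if ∀ d ∈ t, e x d = 1 then 1 else 0) ∂μ - m) := by
      rw [integral_const_mul, integral_finsetSum _ fun n _ => hint _, Finset.sum_sub_distrib,
        Finset.sum_const, Finset.card_range, nsmul_eq_mul]
      field_simp
    rw [h2, norm_mul, norm_inv, RCLike.norm_natCast]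
    have h3 : ‖∑ n ∈ Finset.range N, (∫ x,
        (e x (b + n • a) : ℂ) * (if ∀ d ∈ t, e x d = 1 then 1 else 0) ∂μ - m)‖ ≤ N * ε := by
      refine (norm_sum_le_of_le _ fun n _ => ih _ (L.add_mem hb (L.nsmul_mem ha n))).trans ?_
      rw [Finset.sum_const, Finset.card_range, nsmul_eq_mul]
    have hN0 : (0 : ℝ) < N := by positivity
    rw [inv_mul_le_iff₀ hN0]
    exact h3

/-- The case `b = 0`, `m = μ(X)` of the preceding bound: the event that all `e x d` are `1` has
nearly full measure, with an error independent of the size of `t`. -/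
theorem measureReal_exists_ne_one_le (he : ∀ d, Measurable fun x => (e x d : ℂ))
    (L : AddSubgroup D) {ε : ℝ} (hL : ∀ d ∈ L, ‖∫ x, (e x d : ℂ) ∂μ - μ.real univ‖ ≤ ε)
    (t : Finset D) (ht : ∀ d ∈ t, d ∈ L) : μ.real {x | ∃ d ∈ t, e x d ≠ 1} ≤ ε := by
  classical
  have h1 := norm_integral_char_indicator_sub_le he L hL t ht 0 L.zero_mem
  have hm : MeasurableSet {x | ∀ d ∈ t, e x d = 1} := by
    have : {x | ∀ d ∈ t, e x d = 1} = ⋂ d ∈ t, (fun x => (e x d : ℂ)) ⁻¹' {1} := by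
      ext x; simp [Circle.coe_eq_one]
    rw [this]
    exact Finset.measurableSet_biInter t fun d _ => he d (measurableSet_singleton 1)
  have h2 : ∫ x, (e x 0 : ℂ) * (if ∀ d ∈ t, e x d = 1 then 1 else 0) ∂μ =
      (μ.real {x | ∀ d ∈ t, e x d = 1} : ℂ) := by
    have : ∀ x, (e x 0 : ℂ) * (if ∀ d ∈ t, e x d = 1 then 1 else 0) =
        {x | ∀ d ∈ t, e x d = 1}.indicator (fun _ => (1 : ℂ)) x := fun x => by
      simp [indicator_apply]
    simp only [this]
    rw [integral_indicator_const _ hm]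
    simp
  have h3 : {x | ∃ d ∈ t, e x d ≠ 1} = {x | ∀ d ∈ t, e x d = 1}ᶜ := by
    ext x; simp
  rw [h2, ← Complex.ofReal_sub, Complex.norm_real, Real.norm_eq_abs] at h1
  rw [h3, measureReal_compl hm]
  linarith [neg_abs_le (μ.real {x | ∀ d ∈ t, e x d = 1} - μ.real univ)]

/-- Equicontinuity of a random character on a subgroup: the probability that the character is
nontrivial on the subgroup. -/
theorem measure_nontrivial_le [TopologicalSpace X] [BorelSpace X] [μ.Regular]
    (he : ∀ d, Continuous fun x => e x d) (L : AddSubgroup D) {ε : ℝ}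
    (hL : ∀ d ∈ L, ‖∫ x, (e x d : ℂ) ∂μ - μ.real univ‖ ≤ ε) :
    μ {x | ∃ d ∈ L, e x d ≠ 1} ≤ ENNReal.ofReal ε := by
  have hco : Continuous fun z : Circle => (z : ℂ) := by fun_prop
  have hopen : ∀ d, IsOpen {x | e x d ≠ 1} := fun d =>
    (isClosed_eq (he d) continuous_const).isOpen_compl
  have hU : {x | ∃ d ∈ L, e x d ≠ 1} = ⋃ d : L, {x | e x d ≠ 1} := by
    ext x; simp
  -- The union may be uncountable. Inner regularity reduces it to compact subsets, each covered by
  -- finitely many of the open sets, and the finite bound is uniform.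
  rw [hU, (isOpen_iUnion fun d : L => hopen d).measure_eq_iSup_isCompact]
  refine iSup_le fun K => iSup_le fun hKU => iSup_le fun hK => ?_
  obtain ⟨t, ht⟩ := hK.elim_finite_subcover (fun d : L => {x | e x d ≠ 1}) (fun d => hopen d) hKU
  have h1 := measureReal_exists_ne_one_le (μ := μ) (e := e)
    (fun d => (hco.comp (he d)).measurable) L hL (t.map (Function.Embedding.subtype _))
    (fun d hd => by
      obtain ⟨d', -, rfl⟩ := Finset.mem_map.1 hd
      exact d'.2)
  rw [← ENNReal.ofReal_toReal (measure_ne_top μ K)]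
  refine ENNReal.ofReal_le_ofReal (le_trans ?_ h1)
  refine measureReal_mono (ht.trans fun x hx => ?_)
  obtain ⟨d, hd, hx⟩ := mem_iUnion₂.1 hx
  exact ⟨d, Finset.mem_map.2 ⟨d, hd, rfl⟩, hx⟩

end RandomCharacters

/-! ### From random characters of `F` to random elements of `F` -/

section RandomElement

variable {F : Type*} [NontriviallyNormedField F] [IsUltrametricDist F] [LocallyCompactSpace F]
  {ϖ : F} {χ : AddChar F Circle}

/-- A random character of `F` which is stochastically continuous is given by a random element of
`F`. -/
theorem exists_random_element {X : Type*} [TopologicalSpace X] [CompactSpace X] [T2Space X]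
    [MeasurableSpace X] [BorelSpace X] {μ : Measure X} [μ.Regular] [IsFiniteMeasure μ]
    (hϖ : IsUniformizer ϖ) (hχ : Continuous χ) (hχ1 : ∀ x : F, ‖x‖ ≤ 1 → χ x = 1)
    (hχn : ∃ x y : F, ‖x‖ ≤ 1 ∧ ‖y‖ ≤ 1 ∧ χ (ϖ⁻¹ * x) ≠ χ (ϖ⁻¹ * y))
    {e : X → AddChar F Circle} (he : ∀ a, Continuous fun x => e x a)
    (hcont : Tendsto (fun a => ∫ x, (e x a : ℂ) ∂μ) (𝓝 0) (𝓝 (μ.real univ))) :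
    ∃ s : X → F, (∀ C, IsClosed C → MeasurableSet {x | s x ∈ C}) ∧
      ∀ᵐ x ∂μ, ∀ a, e x a = χ (a * s x) := by
  classical
  have := properSpace_field (F := F)
  let R : Set X := {x | ∃ s, ∀ a, e x a = χ (a * s)}
  -- The condition involves uncountably many `a`, so measurability is obtained topologically: with
  -- `s` confined to a compact set, `A C k` is the projection of a compact set, hence closed.
  let A : Set F → ℕ → Set X := fun C k => {x | ∃ s, s ∈ C ∧ ‖s‖ ≤ k ∧ ∀ a, e x a = χ (a * s)}
  have hA : ∀ C, IsClosed C → ∀ k, IsClosed (A C k) := fun C hC k => by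
    let B : Set (X × F) := (univ ×ˢ (Metric.closedBall 0 k ∩ C)) ∩
      ⋂ a : F, {p | e p.1 a = χ (a * p.2)}
    have hB : IsCompact B := by
      refine (isCompact_univ.prod ((isCompact_closedBall 0 _).inter_right hC)).inter_right
        (isClosed_iInter fun a => isClosed_eq ((he a).comp continuous_fst) ?_)
      exact hχ.comp (continuous_const.mul continuous_snd)
    have hAB : A C k = Prod.fst '' B := by
      ext x
      constructor
      · rintro ⟨s, h1, h2, h3⟩
        exact ⟨(x, s), ⟨⟨trivial, by simpa using h2, h1⟩, mem_iInter.2 h3⟩, rfl⟩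
      · rintro ⟨⟨x, s⟩, ⟨⟨-, h2, h1⟩, h3⟩, rfl⟩
        exact ⟨s, h1, by simpa using h2, mem_iInter.1 h3⟩
    rw [hAB]
    exact (hB.image continuous_fst).isClosed
  have hRA : ∀ C : Set F, {x | ∃ s, s ∈ C ∧ ∀ a, e x a = χ (a * s)} = ⋃ k, A C k := fun C => by
    ext x
    rw [mem_iUnion]
    constructor
    · rintro ⟨s, h1, h2⟩
      obtain ⟨k, hk⟩ := exists_nat_ge ‖s‖
      exact ⟨k, s, h1, hk, h2⟩
    · rintro ⟨k, s, h1, -, h2⟩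
      exact ⟨s, h1, h2⟩
  have hRm : MeasurableSet R := by
    have : R = {x | ∃ s, s ∈ (univ : Set F) ∧ ∀ a, e x a = χ (a * s)} := by simp [R]
    rw [this, hRA]
    exact MeasurableSet.iUnion fun k => (hA univ isClosed_univ k).measurableSet
  -- The value `0` off `R` is arbitrary; it accounts for the second piece in the description of `{x
  -- | s x ∈ C}` below.
  let s : X → F := fun x => if h : x ∈ R then h.choose else 0
  have hs : ∀ x (_ : x ∈ R) a, e x a = χ (a * s x) := fun x h => by
    simp only [s, dif_pos h]
    exact h.choose_spec
  have huniq : ∀ x t, (∀ a, e x a = χ (a * t)) → t = s x := fun x t ht => by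
    refine sub_eq_zero.1 (eq_zero_of_char_trivial hχn fun a => ?_)
    rw [mul_sub, AddChar.map_sub_eq_div, ← ht, ← hs x ⟨t, ht⟩, div_self']
  refine ⟨s, fun C hC => ?_, ?_⟩
  · have h1 : {x | s x ∈ C} = (⋃ k, A C k) ∪ (Rᶜ ∩ {_x | (0 : F) ∈ C}) := by
      ext x
      rw [← hRA]
      by_cases hx : x ∈ R
      · refine ⟨fun h => Or.inl ⟨s x, h, hs x hx⟩, ?_⟩
        rintro (⟨t, h1, h2⟩ | h)
        · change s x ∈ C
          rwa [← huniq x t h2]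
        · exact absurd hx h.1
      · have h0 : s x = 0 := dif_neg hx
        change s x ∈ C ↔ _
        rw [h0]
        refine ⟨fun h => Or.inr ⟨hx, h⟩, ?_⟩
        rintro (⟨t, h1, h2⟩ | h)
        · exact absurd ⟨t, h2⟩ hx
        · exact h.2
    rw [h1]
    exact (MeasurableSet.iUnion fun k => (hA C hC k).measurableSet).union
      (hRm.compl.inter (MeasurableSet.const _))
  · have h0 : μ Rᶜ = 0 := by
      refine le_antisymm (ENNReal.le_of_forall_pos_le_add fun δ hδ _ => ?_) zero_le
      obtain ⟨r, hr, hball⟩ := Metric.eventually_nhds_iff.1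
        (Metric.tendsto_nhds.1 hcont δ (NNReal.coe_pos.2 hδ))
      -- A ball is a subgroup by the ultrametric inequality. Its radius is halved because `hball`
      -- demands strict inequality.
      let L : AddSubgroup F :=
        { carrier := {a | ‖a‖ ≤ r / 2}
          add_mem' := fun {a b} ha hb =>
            (IsUltrametricDist.norm_add_le_max a b).trans (max_le ha hb)
          zero_mem' := by
            change ‖(0 : F)‖ ≤ r / 2
            rw [norm_zero]
            positivity
          neg_mem' := fun {a} ha => by
            change ‖-a‖ ≤ r / 2
            rwa [norm_neg] }
      have hL : ∀ d ∈ L, ‖∫ x, (e x d : ℂ) ∂μ - μ.real univ‖ ≤ δ := fun d hd => by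
        rw [← dist_eq_norm]
        refine (hball ?_).le
        rw [dist_zero_right]
        exact lt_of_le_of_lt hd (by linarith)
      rw [zero_add, ← ENNReal.ofReal_coe_nnreal]
      refine (measure_mono fun x hx => ?_).trans (measure_nontrivial_le he L hL)
      by_contra hcon
      refine hx (exists_char_eq hϖ hχ hχ1 hχn (half_pos hr) fun a ha => ?_)
      by_contra hne
      exact hcon ⟨a, ha, hne⟩
    refine (ae_iff.2 ?_ : ∀ᵐ x ∂μ, x ∈ R).mono hs
    exact h0

end RandomElement

/-! ### Families with equal Gram matrices -/

section Gram

variable {ι H H' : Type*} [NormedAddCommGroup H] [InnerProductSpace ℂ H]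
  [NormedAddCommGroup H'] [InnerProductSpace ℂ H']

theorem norm_linearCombination_eq {x : ι → H} {y : ι → H'}
    (h : ∀ i j, inner ℂ (x i) (x j) = inner ℂ (y i) (y j)) (c : ι →₀ ℂ) :
    ‖Finsupp.linearCombination ℂ y c‖ = ‖Finsupp.linearCombination ℂ x c‖ := by
  rw [@norm_eq_sqrt_re_inner ℂ, @norm_eq_sqrt_re_inner ℂ]
  simp only [Finsupp.linearCombination_apply, Finsupp.sum, sum_inner, inner_sum, inner_smul_left,
    inner_smul_right, h]

theorem denseRange_linearCombination {x : ι → H}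
    (hx : (Submodule.span ℂ (range x)).topologicalClosure = ⊤) :
    DenseRange (Finsupp.linearCombination ℂ x) := by
  rw [DenseRange, ← LinearMap.coe_range, Finsupp.range_linearCombination]
  exact Submodule.dense_iff_topologicalClosure_eq_top.2 hx

/-- Two total families with the same Gram matrix are related by a unitary operator. -/
theorem exists_unitary_of_gram [CompleteSpace H] [CompleteSpace H'] {x : ι → H} {y : ι → H'}
    (hx : (Submodule.span ℂ (range x)).topologicalClosure = ⊤)
    (hy : (Submodule.span ℂ (range y)).topologicalClosure = ⊤)
    (h : ∀ i j, inner ℂ (x i) (x j) = inner ℂ (y i) (y j)) :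
    ∃ U : H ≃ₗᵢ[ℂ] H', ∀ i, U (x i) = y i := by
  have hdx := denseRange_linearCombination hx
  have hdy := denseRange_linearCombination hy
  refine ⟨(LinearEquiv.refl ℂ (ι →₀ ℂ)).extendOfIsometry (Finsupp.linearCombination ℂ x)
    (Finsupp.linearCombination ℂ y) hdx hdy (norm_linearCombination_eq h), fun i => ?_⟩
  have h1 := LinearEquiv.extendOfIsometry_eq (LinearEquiv.refl ℂ (ι →₀ ℂ))
    (Finsupp.linearCombination ℂ x) (Finsupp.linearCombination ℂ y) hdx hdy
    (norm_linearCombination_eq h) (Finsupp.single i 1)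
  simpa using h1

end Gram

/-! ### Realization of spherical representations -/

section Realization

variable {F : Type*} [NontriviallyNormedField F] [IsUltrametricDist F]

theorem addChar_map_sum {D M ι : Type*} [AddCommMonoid D] [CommMonoid M] (ψ : AddChar D M)
    (f : ι → D) (t : Finset ι) : ψ (∑ i ∈ t, f i) = ∏ i ∈ t, ψ (f i) := by
  classical
  induction t using Finset.induction with
  | empty => simp
  | insert a t ha ih => rw [Finset.sum_insert ha, Finset.prod_insert ha, ψ.map_add_eq_mul, ih]

theorem MotionGroup.mk_mul_mk_one (A : SymInf F) (g : GLInf F) :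
    MotionGroup.mk A 1 * MotionGroup.mk 0 g = MotionGroup.mk A g := by
  rw [mk_mul_mk, ofAdd_zero, smul_one, toAdd_one, add_zero, one_mul]

theorem MotionGroup.mk_zero_mul_mk (A : SymInf F) (g h : GLInf F) :
    MotionGroup.mk 0 g * MotionGroup.mk A h =
      MotionGroup.mk (g • Multiplicative.ofAdd A).toAdd (g * h) := by
  rw [mk_mul_mk, zero_add]

theorem MotionGroup.mk_one_mul_mk_one (A B : SymInf F) :
    MotionGroup.mk A 1 * MotionGroup.mk B 1 = MotionGroup.mk (A + B) 1 := by
  rw [mk_mul_mk, one_smul, toAdd_ofAdd, one_mul]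

theorem MotionGroup.mk_zero_one : MotionGroup.mk (0 : SymInf F) 1 = 1 := rfl

theorem MotionGroup.mk_one_inv (A : SymInf F) :
    (MotionGroup.mk A 1)⁻¹ = MotionGroup.mk (-A) 1 :=
  inv_eq_of_mul_eq_one_right (by rw [mk_one_mul_mk_one, add_neg_cancel, mk_zero_one])

theorem MotionGroup.exists_eq_mk (x : MotionGroup F) : ∃ A g, x = MotionGroup.mk A g :=
  ⟨x.left.toAdd, x.right, rfl⟩

/-- The line factors through the finite stage of size `max (i + 1) (j + 1)`. It gives the stochastic
continuity of the random character along the entry `(i, j)`. -/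
theorem continuous_mk_symUnit (i j : ℕ) :
    Continuous fun a : F => MotionGroup.mk (symUnit i j a) 1 := by
  set n := max (i + 1) (j + 1)
  let i' : Fin n := ⟨i, by omega⟩
  let j' : Fin n := ⟨j, by omega⟩
  let f : F → {a : Matrix (Fin n) (Fin n) F // a.IsSymm} × GL (Fin n) (IntRing F) := fun a =>
    (⟨Matrix.single i' j' a + Matrix.single j' i' a, by
      rw [Matrix.IsSymm, Matrix.transpose_add, Matrix.transpose_single, Matrix.transpose_single,
        add_comm]⟩, 1)
  have hf : Continuous f := by
    refine (Continuous.subtype_mk (continuous_matrix fun k l => ?_) _).prodMk continuous_const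
    simp only [Matrix.add_apply, Matrix.single_apply]
    split_ifs <;> fun_prop
  have hs : Continuous (MotionGroup.stage (F := F) n) :=
    continuous_iSup_rng (i := n) continuous_coinduced_rng
  refine (hs.comp hf).congr fun a => ?_
  have h1 : (MotionGroup.stage n (f a)) = MotionGroup.mk (symUnit i j a) (cornerGL F n 1) := by
    unfold MotionGroup.stage
    congr 1
    refine Subtype.ext (Matrix.ext fun k l => ?_)
    change extendZero n (Matrix.single i' j' a + Matrix.single j' i' a) k l =
      (Matrix.single i j a + Matrix.single j i a) k l
    unfold extendZero
    split_ifs with h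
    · simp only [Matrix.add_apply, Matrix.single_apply, i', j', Fin.ext_iff]
    · rw [Matrix.add_apply, Matrix.single_apply_of_ne _ _ _ _ _ (by omega),
        Matrix.single_apply_of_ne _ _ _ _ _ (by omega), add_zero]
  rw [Function.comp, h1, map_one]

variable [LocallyCompactSpace F] {ϖ : F} {χ : AddChar F Circle}
  {H : Type*} [NormedAddCommGroup H] [InnerProductSpace ℂ H] [CompleteSpace H]

/-- The matrix coefficients of a continuous representation along `Sym(∞, F)` are Fourier transforms
of finite measures on `Sym(ℕ, F)`. -/
theorem exists_measure_fourier (h2 : (2 : F) ≠ 0) (hϖ : IsUniformizer ϖ) (hχ : Continuous χ)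
    (hχ1 : ∀ x : F, ‖x‖ ≤ 1 → χ x = 1)
    (hχn : ∃ x y : F, ‖x‖ ≤ 1 ∧ ‖y‖ ≤ 1 ∧ χ (ϖ⁻¹ * x) ≠ χ (ϖ⁻¹ * y))
    (ρ : MotionGroup F →* (H ≃ₗᵢ[ℂ] H)) (v : H) (hρ : Continuous fun x => ρ x v) :
    ∃ ν : Measure (SymN F), IsFiniteMeasure ν ∧
      ∀ A, ∫ S, charB hχ A S ∂ν = inner ℂ v (ρ (MotionGroup.mk A 1) v) := by
  let π : Multiplicative (SymInf F) →* (H ≃ₗᵢ[ℂ] H) :=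
    { toFun := fun A => ρ (MotionGroup.mk A.toAdd 1)
      map_one' := by rw [toAdd_one, MotionGroup.mk_zero_one, map_one]
      map_mul' := fun A B => by rw [← map_mul, MotionGroup.mk_one_mul_mk_one, toAdd_mul] }
  obtain ⟨X, _, _, _, _, _, μ, e, _, _, hec, hμ⟩ := exists_spectral_measure π v
  have hμ' : ∀ A, ∫ x, (e x A : ℂ) ∂μ = inner ℂ v (ρ (MotionGroup.mk A 1) v) := hμ
  let ι : ℕ → ℕ → F →+ SymInf F := fun i j => AddMonoidHom.mk' (symUnit i j) (symUnit_add i j)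
  have hs : ∀ i j, ∃ s : X → F, (∀ C, IsClosed C → MeasurableSet {x | s x ∈ C}) ∧
      ∀ᵐ x ∂μ, ∀ a, e x (symUnit i j a) = χ (a * s x) := fun i j => by
    refine exists_random_element hϖ hχ hχ1 hχn (e := fun x => (e x).compAddMonoidHom (ι i j))
      (fun a => hec _) ?_
    have h1 : Continuous fun a : F => inner ℂ v (ρ (MotionGroup.mk (symUnit i j a) 1) v) :=
      continuous_const.inner (hρ.comp (continuous_mk_symUnit i j))
    have h3 : (μ.real univ : ℂ) = inner ℂ v (ρ (MotionGroup.mk (symUnit i j 0) 1) v) := by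
      rw [← hμ', show symUnit i j (0 : F) = 0 from map_zero (ι i j)]
      simp
    rw [h3]
    refine (h1.tendsto 0).congr fun a => (hμ' (symUnit i j a)).symm
  choose s hsm hse using hs
  -- The halving compensates the factor `2` in `pairing_symUnit`; the minimum and maximum of the
  -- indices make the matrix symmetric.
  let S : X → SymN F := fun x => ⟨Matrix.of fun i j => s (min i j) (max i j) x / 2,
    Matrix.IsSymm.ext fun i j => by
      simp only [Matrix.of_apply, min_comm i j, max_comm i j]⟩
  have hSm : Measurable S := measurable_symN fun i j C hC =>
    hsm (min i j) (max i j) ((fun a => a / 2) ⁻¹' C) (hC.preimage (by fun_prop))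
  -- Only countably many null sets are discarded, one for each entry. Outside them the identity for
  -- all `A` is purely algebraic, since the elementary matrices generate `Sym(∞, F)`.
  have hae : ∀ᵐ x ∂μ, ∀ A, e x A = χ (pairing A (S x)) := by
    filter_upwards [ae_all_iff.2 fun i => ae_all_iff.2 (hse i)] with x hx A
    obtain ⟨n, hn⟩ := A.2.2
    have hx' : ∀ i j a, e x (symUnit i j a) = χ (a * s (min i j) (max i j) x) := fun i j a => by
      rcases le_total i j with h | h
      · rw [min_eq_left h, max_eq_right h, hx]
      · rw [min_eq_right h, max_eq_left h, symUnit_comm, hx]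
    rw [pairing_eq_sum hn, addChar_map_sum]
    conv_lhs => rw [eq_sum_symUnit h2 hn, addChar_map_sum]
    refine Finset.prod_congr rfl fun i _ => ?_
    rw [addChar_map_sum, addChar_map_sum]
    refine Finset.prod_congr rfl fun j _ => ?_
    rw [hx']
    congr 1
    exact div_mul_eq_mul_div₀ _ _ _ |>.trans (mul_div_assoc _ _ _)
  refine ⟨μ.map S, inferInstance, fun A => ?_⟩
  rw [integral_map hSm.aemeasurable (charB hχ A).continuous.aestronglyMeasurable, ← hμ']
  refine integral_congr_ae ?_
  filter_upwards [hae] with x hx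
  rw [charB_apply, hx]

/-- As `v` is fixed, `ρ(gᵗAg)v = ρ(gᵗ)ρ(A)v` has the same inner product with `v` as `ρ(A)v`. Thus
the translate of `ν` by `g` has the same Fourier transform as `ν`. -/
theorem smulInvariantMeasure_of_fourier (h2 : (2 : F) ≠ 0) (hχ : Continuous χ) (hχ1 : χ ≠ 1)
    {ρ : MotionGroup F →* (H ≃ₗᵢ[ℂ] H)} {v : H} (hv : ∀ g, ρ (MotionGroup.mk 0 g) v = v)
    {ν : Measure (SymN F)} [IsFiniteMeasure ν]
    (hν : ∀ A, ∫ S, charB hχ A S ∂ν = inner ℂ v (ρ (MotionGroup.mk A 1) v)) :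
    SMulInvariantMeasure (GLInf F) (SymN F) ν := by
  have hmap : ∀ g : GLInf F, ν.map (fun S => g • S) = ν := fun g => by
    refine measure_ext_of_charB h2 hχ hχ1 fun A => ?_
    rw [integral_map (continuous_smul_symN g).measurable.aemeasurable
      (charB hχ A).continuous.aestronglyMeasurable]
    have htt : g.transpose.transpose = g :=
      GLInf.mat_injective (by rw [GLInf.mat_transpose, GLInf.mat_transpose,
        Matrix.transpose_transpose])
    have h1 : ∀ S, charB hχ A (g • S) =
        charB hχ (g.transpose • Multiplicative.ofAdd A).toAdd S := fun S => by
      rw [charB_apply, charB_apply, pairing_smul, htt]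
    simp only [h1]
    rw [hν, hν]
    have h3 : MotionGroup.mk (g.transpose • Multiplicative.ofAdd A).toAdd 1 *
        MotionGroup.mk 0 g.transpose = MotionGroup.mk 0 g.transpose * MotionGroup.mk A 1 := by
      rw [MotionGroup.mk_mul_mk_one, MotionGroup.mk_zero_mul_mk, mul_one]
    have h4 : ρ (MotionGroup.mk (g.transpose • Multiplicative.ofAdd A).toAdd 1) v =
        ρ (MotionGroup.mk 0 g.transpose) (ρ (MotionGroup.mk A 1) v) := by
      rw [← rep_mul_apply, ← h3, rep_mul_apply, hv]
    rw [h4]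
    nth_rw 1 [← hv g.transpose]
    rw [LinearIsometryEquiv.inner_map_map]
  refine ⟨fun g s hs => ?_⟩
  rw [← Measure.map_apply (continuous_smul_symN g).measurable hs, hmap]

/-- The relation `ρ(g)ρ(B)v = ρ(gBgᵗ)v` makes the span of the `Sym(∞, F)`-orbit invariant under the
whole group. Its closure contains `v ≠ 0`, so irreducibility makes it everything. -/
theorem span_sym_orbit_dense {ρ : MotionGroup F →* (H ≃ₗᵢ[ℂ] H)} (hρ : IsSpherical ρ) {v : H}
    (hv0 : v ≠ 0) (hv : ∀ g, ρ (MotionGroup.mk 0 g) v = v) :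
    (Submodule.span ℂ (range fun A => ρ (MotionGroup.mk A 1) v)).topologicalClosure = ⊤ := by
  set V := Submodule.span ℂ (range fun A => ρ (MotionGroup.mk A 1) v) with hV
  have hinv : ∀ x, ∀ w ∈ V, ρ x w ∈ V := fun x w hw => by
    obtain ⟨A, g, rfl⟩ := x.exists_eq_mk
    induction hw using Submodule.span_induction with
    | mem w hw =>
      obtain ⟨B, rfl⟩ := hw
      refine Submodule.subset_span ⟨A + (g • Multiplicative.ofAdd B).toAdd, ?_⟩
      change ρ (MotionGroup.mk (A + (g • Multiplicative.ofAdd B).toAdd) 1) v =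
        ρ (MotionGroup.mk A g) (ρ (MotionGroup.mk B 1) v)
      rw [← rep_mul_apply, MotionGroup.mk_mul_mk, mul_one,
        ← MotionGroup.mk_mul_mk_one (A + _) g, rep_mul_apply, hv]
    | zero => simp
    | add w w' _ _ h h' => rw [map_add]; exact V.add_mem h h'
    | smul c w _ h => rw [map_smul]; exact V.smul_mem c h
  rcases hρ.irreducible V.topologicalClosure V.isClosed_topologicalClosure fun x w hw =>
    map_mem_closure (ρ x).continuous hw (hinv x) with h | h
  · have h1 : v ∈ V.topologicalClosure := V.le_topologicalClosure
      (Submodule.subset_span ⟨0, by beta_reduce; rw [MotionGroup.mk_zero_one, map_one]; rfl⟩)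
    rw [h] at h1
    exact absurd h1 hv0
  · exact h

/-- For an invariant Borel set `B` the functions vanishing off `B` form a closed invariant subspace.
If it is zero, the indicator of `B` is null; if it is everything, the constant `1` vanishes off `B`.
-/
theorem isErgodicProb_of_irreducible (hχ : Continuous χ) {ν : Measure (SymN F)}
    [IsProbabilityMeasure ν] [SMulInvariantMeasure (GLInf F) (SymN F) ν]
    (hirr : ∀ W : Submodule ℂ (Lp ℂ 2 ν), IsClosed (W : Set (Lp ℂ 2 ν)) →
      (∀ x, ∀ ξ ∈ W, rhoNu hχ ν x ξ ∈ W) → W = ⊥ ∨ W = ⊤) : IsErgodicProb ν where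
  isProb := inferInstance
  invariant := inferInstance
  ergodic B hB hinv := by
    let R := LpToLpRestrictCLM (SymN F) ℂ ℂ ν 2 Bᶜ
    let W : Submodule ℂ (Lp ℂ 2 ν) := LinearMap.ker R.toLinearMap
    have hW : ∀ ξ : Lp ℂ 2 ν, ξ ∈ W ↔ ∀ᵐ S ∂ν, S ∈ Bᶜ → ξ S = 0 := fun ξ => by
      rw [← ae_restrict_iff' hB.compl]
      change R ξ = 0 ↔ _
      rw [Lp.eq_zero_iff_ae_eq_zero]
      have h1 := LpToLpRestrictCLM_coeFn ℂ Bᶜ ξ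
      exact ⟨fun h => h1.symm.trans h, fun h => h1.trans h⟩
    have hWc : IsClosed (W : Set (Lp ℂ 2 ν)) := R.isClosed_ker
    rcases hirr W hWc fun x ξ hξ => by
      obtain ⟨A, g, rfl⟩ := x.exists_eq_mk
      rw [hW] at hξ ⊢
      filter_upwards [coeFn_rhoNu hχ ν A g ξ,
        (measurePreserving_smul_symN ν g.transpose).quasiMeasurePreserving.ae hξ] with S h1 h3 hS
      rw [h1, h3, mul_zero]
      intro hS'
      refine hS ?_
      rw [← hinv g.transpose]
      exact hS' with h | h
    · left
      have h1 : indicatorConstLp 2 hB (measure_ne_top ν B) (1 : ℂ) ∈ W := by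
        rw [hW]
        filter_upwards [indicatorConstLp_coeFn (p := 2) (hs := hB) (hμs := measure_ne_top ν B)
          (c := (1 : ℂ))] with S h1 hS
        rw [h1, indicator_of_notMem hS]
      rw [h, Submodule.mem_bot, Lp.eq_zero_iff_ae_eq_zero] at h1
      rw [measure_eq_zero_iff_ae_notMem]
      filter_upwards [h1, indicatorConstLp_coeFn (p := 2) (hs := hB) (hμs := measure_ne_top ν B)
          (c := (1 : ℂ))] with S h1 h3 hS
      rw [h3, indicator_of_mem hS] at h1
      exact one_ne_zero h1
    · right
      have h1 : charL hχ ν 0 ∈ W := h ▸ Submodule.mem_top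
      rw [hW] at h1
      rw [measure_eq_zero_iff_ae_notMem]
      filter_upwards [h1, coeFn_charL hχ ν 0] with S h1 h3 hS
      have := h1 hS
      rw [h3] at this
      exact Circle.coe_ne_zero _ this

theorem irreducible_of_unitarilyEquivalent {G H H' : Type*} [Group G] [NormedAddCommGroup H]
    [InnerProductSpace ℂ H] [NormedAddCommGroup H'] [InnerProductSpace ℂ H']
    {ρ : G →* (H ≃ₗᵢ[ℂ] H)} {ρ' : G →* (H' ≃ₗᵢ[ℂ] H')} (h : UnitarilyEquivalent ρ ρ')
    (hρ : ∀ W : Submodule ℂ H, IsClosed (W : Set H) → (∀ x, ∀ v ∈ W, ρ x v ∈ W) → W = ⊥ ∨ W = ⊤)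
    (W : Submodule ℂ H') (hW : IsClosed (W : Set H')) (hinv : ∀ x, ∀ v ∈ W, ρ' x v ∈ W) :
    W = ⊥ ∨ W = ⊤ := by
  obtain ⟨U, hU⟩ := h
  have hmem : ∀ v, v ∈ W.comap U.toLinearEquiv.toLinearMap ↔ U v ∈ W := fun v => Iff.rfl
  rcases hρ (W.comap U.toLinearEquiv.toLinearMap) (hW.preimage U.continuous) fun x v hv => by
    rw [hmem] at hv ⊢
    rw [hU]
    exact hinv x _ hv with h | h
  · left
    refine (Submodule.eq_bot_iff _).2 fun w hw => ?_
    have h1 : U.symm w ∈ W.comap U.toLinearEquiv.toLinearMap := by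
      rw [hmem, U.apply_symm_apply]
      exact hw
    rw [h, Submodule.mem_bot] at h1
    simpa using congrArg U h1
  · right
    refine Submodule.eq_top_iff'.2 fun w => ?_
    have h1 : U.symm w ∈ W.comap U.toLinearEquiv.toLinearMap := h ▸ Submodule.mem_top
    rwa [hmem, U.apply_symm_apply] at h1

/-- With `v` normalized, `ν` is a probability measure. The families `ρ(A)v` and `charL hχ ν A` are
total and have the same Gram matrix, since the entry at `(A, B)` is in both cases the Fourier
transform of `ν` at `B - A`. The resulting unitary intertwines the actions on these families, hence
everywhere, and transports irreducibility to `ρ_ν`. -/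
theorem exists_ergodic_of_spherical (h2 : (2 : F) ≠ 0) (hϖ : IsUniformizer ϖ) (hχ : Continuous χ)
    (hχ1 : ∀ x : F, ‖x‖ ≤ 1 → χ x = 1)
    (hχn : ∃ x y : F, ‖x‖ ≤ 1 ∧ ‖y‖ ≤ 1 ∧ χ (ϖ⁻¹ * x) ≠ χ (ϖ⁻¹ * y)) (hχne : χ ≠ 1)
    (ρ : MotionGroup F →* (H ≃ₗᵢ[ℂ] H)) (hρ : IsSpherical ρ) :
    ∃ (ν : Measure (SymN F)) (hν : IsErgodicProb ν),
      haveI := hν.invariant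
      UnitarilyEquivalent ρ (rhoNu hχ ν) := by
  obtain ⟨w, hw0, hw⟩ := hρ.exists_invariant
  let v : H := ((‖w‖⁻¹ : ℝ) : ℂ) • w
  have hv1 : ‖v‖ = 1 := by
    rw [norm_smul, Complex.norm_real, norm_inv, norm_norm,
      inv_mul_cancel₀ (norm_ne_zero_iff.2 hw0)]
  have hv : ∀ g, ρ (MotionGroup.mk 0 g) v = v := fun g => by rw [map_smul, hw]
  have hv0 : v ≠ 0 := norm_ne_zero_iff.1 (by rw [hv1]; exact one_ne_zero)
  obtain ⟨ν, _, hν⟩ := exists_measure_fourier h2 hϖ hχ hχ1 hχn ρ v (hρ.continuous v)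
  have hprob : IsProbabilityMeasure ν := by
    have h1 := hν 0
    rw [MotionGroup.mk_zero_one, map_one, charB_zero, LinearIsometryEquiv.coe_one, id,
      inner_self_eq_norm_sq_to_K, hv1] at h1
    simp only [BoundedContinuousFunction.coe_one, Pi.one_apply, integral_const, Complex.real_smul,
      mul_one] at h1
    have h3 : ν.real univ = 1 := Complex.ofReal_injective (by simpa using h1)
    exact ⟨by rw [← ENNReal.ofReal_toReal (measure_ne_top ν univ)]; exact
      (congrArg ENNReal.ofReal h3).trans ENNReal.ofReal_one⟩
  have hinv := smulInvariantMeasure_of_fourier h2 hχ hχne hv hν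
  have hd := span_sym_orbit_dense hρ hv0 hv
  obtain ⟨U, hU⟩ := exists_unitary_of_gram hd (span_charL_dense h2 hχ hχne ν) fun A B => by
    rw [inner_charL_charL, hν, inner_rep_left, MotionGroup.mk_one_inv, ← rep_mul_apply,
      MotionGroup.mk_one_mul_mk_one, neg_add_eq_sub]
  have hequiv : UnitarilyEquivalent ρ (rhoNu hχ ν) := by
    refine ⟨U, fun x u => ?_⟩
    have hext : (U.toContinuousLinearEquiv : H →L[ℂ] Lp ℂ 2 ν) ∘L
        ((ρ x).toContinuousLinearEquiv : H →L[ℂ] H) =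
        ((rhoNu hχ ν x).toContinuousLinearEquiv : Lp ℂ 2 ν →L[ℂ] Lp ℂ 2 ν) ∘L
          (U.toContinuousLinearEquiv : H →L[ℂ] Lp ℂ 2 ν) := by
      refine ContinuousLinearMap.ext_on (Submodule.dense_iff_topologicalClosure_eq_top.2 hd) ?_
      rintro _ ⟨B, rfl⟩
      obtain ⟨A, g, rfl⟩ := x.exists_eq_mk
      change U (ρ (MotionGroup.mk A g) (ρ (MotionGroup.mk B 1) v)) =
        rhoNu hχ ν (MotionGroup.mk A g) (U (ρ (MotionGroup.mk B 1) v))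
      rw [hU, rhoNu_charL, ← hU, ← rep_mul_apply, MotionGroup.mk_mul_mk, mul_one,
        ← MotionGroup.mk_mul_mk_one (A + _) g, rep_mul_apply, hv]
    exact DFunLike.congr_fun hext u
  have herg := isErgodicProb_of_irreducible hχ
    (irreducible_of_unitarilyEquivalent hequiv hρ.irreducible)
  exact ⟨ν, herg, hequiv⟩

end Realization

end CartanMotion

end

/-! ### The bijection between ergodic measures and spherical representations -/

theorem proposition1p5 {F : Type*} [NontriviallyNormedField F] [IsUltrametricDist F]
    [LocallyCompactSpace F] (h2 : (2 : F) ≠ 0)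
    (ϖ : F) (hϖ : CartanMotion.IsUniformizer ϖ)
    (χ : AddChar F Circle) (hχ : Continuous χ)
    (hχ_trivial : ∀ x : F, ‖x‖ ≤ 1 → χ x = 1)
    (hχ_nontrivial : ∃ x y : F, ‖x‖ ≤ 1 ∧ ‖y‖ ≤ 1 ∧ χ (ϖ⁻¹ * x) ≠ χ (ϖ⁻¹ * y)) :
    -- every `ρ_ν` is a spherical representation
    (∀ (ν : MeasureTheory.Measure (CartanMotion.SymN F)) (hν : CartanMotion.IsErgodicProb ν),
      haveI := hν.invariant
      CartanMotion.IsSpherical (CartanMotion.rhoNu hχ ν)) ∧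
    -- measures with unitarily equivalent representations coincide
    (∀ (ν ν' : MeasureTheory.Measure (CartanMotion.SymN F)) (hν : CartanMotion.IsErgodicProb ν)
      (hν' : CartanMotion.IsErgodicProb ν'),
      haveI := hν.invariant
      haveI := hν'.invariant
      CartanMotion.UnitarilyEquivalent (CartanMotion.rhoNu hχ ν) (CartanMotion.rhoNu hχ ν') →
        ν = ν') ∧
    -- every spherical representation is unitarily equivalent to some `ρ_ν`
    (∀ (H : Type*) [NormedAddCommGroup H] [InnerProductSpace ℂ H] [CompleteSpace H]
      (ρ : CartanMotion.MotionGroup F →* (H ≃ₗᵢ[ℂ] H)), CartanMotion.IsSpherical ρ →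
      ∃ (ν : MeasureTheory.Measure (CartanMotion.SymN F)) (hν : CartanMotion.IsErgodicProb ν),
        haveI := hν.invariant
        CartanMotion.UnitarilyEquivalent ρ (CartanMotion.rhoNu hχ ν)) := by
  have hχ_ne : χ ≠ 1 := by
    rintro rfl
    obtain ⟨x, y, -, -, h⟩ := hχ_nontrivial
    exact h rfl
  refine ⟨fun ν hν => ?_, fun ν ν' hν hν' h => ?_, fun H _ _ _ ρ hρ => ?_⟩
  · have := hν.isProb
    have := hν.invariant
    exact CartanMotion.isSpherical_rhoNu hχ ν h2 hχ_ne hν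
  · have := hν.isProb
    have := hν'.isProb
    have := hν.invariant
    have := hν'.invariant
    exact CartanMotion.measure_eq_of_unitarilyEquivalent hχ h2 hχ_ne ν ν' hν' h
  · exact CartanMotion.exists_ergodic_of_spherical h2 hϖ hχ hχ_trivial hχ_nontrivial hχ_ne ρ hρ
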